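/- Let $q$ be an integer such that $|q|$ is prime or $q=-1$. For a positive integer $N$, let $D_{2,q}(N)$ be the number of $D(q)$-pairs in $\{1,2,\dots,N\}$, that is, of two-element sets $\{a,b\}\subset\{1,2,\dots,N\}$ such that $ab+q$ is the square of an integer. For a non-zero integer $D$ with $D\equiv 0$ or $1\pmod 4$ let $\chi_D$ be the Dirichlet character of modulus $|D|$ given by the Kronecker symbol $\chi_D(n)=\left(\frac{D}{n}\right)$, and let $L(s,\chi_D)$ be its Dirichlet $L$-function (the analytic continuation of $\sum_{n\ge 1}\chi_D(n)n^{-s}$). Then, as $N\to\infty$: a) if $q\equiv 3\pmod 4$, then $\displaystyle D_{2,q}(N)\sim\frac{L(1,\chi_{4q})}{\zeta(2)}\cdot N$; b) if $q\equiv 5\pmod 8$, then $\displaystyle D_{2,q}(N)\sim\frac{2L(1,\chi_{q})}{\zeta(2)}\cdot N$; c) if $q\equiv 1\pmod 8$, then $\displaystyle D_{2,q}(N)\sim\frac{L(1,\chi_{q})}{\zeta(2)}\cdot N$. -/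

import Mathlib

open Filter Asymptotics

/-- A finite set `S` of natural numbers is a `D(q)`-`m`-tuple if it consists of `m` (distinct)
positive integers and `a * b + q` is a perfect square for any two distinct elements `a`, `b`. -/
def IsDTuple (q : ℤ) (m : ℕ) (S : Finset ℕ) : Prop :=
  S.card = m ∧ (∀ a ∈ S, 0 < a) ∧
    ∀ a ∈ S, ∀ b ∈ S, a ≠ b → IsSquare ((a : ℤ) * (b : ℤ) + q)

open Classical in
/-- `dCount m q N` is the number of `D(q)`-`m`-tuples contained in `{1, ..., N}`. -/
noncomputable def dCount (m : ℕ) (q : ℤ) (N : ℕ) : ℕ :=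
  ((Finset.Icc 1 N).powerset.filter (fun S => IsDTuple q m S)).card

/-- The Kronecker symbol `(a / n)` for arbitrary integers `a` and `n`.
For `n ≠ 0`, write `n = ± 2 ^ k * m` with `m` odd and positive; then `(a / n)` is the product of
`(a / ±1)`, of `(a / 2) ^ k`, and of the Jacobi symbol `(a / m)`.  Here `(a / -1)` is `-1` for
`a < 0` and `1` for `0 ≤ a`, while `(a / 2)` is `0` for even `a`, `1` for `a ≡ 1, 7 mod 8` and
`-1` for `a ≡ 3, 5 mod 8`.  Finally `(a / 0)` is `1` if `a = 1` or `a = -1`, and `0` otherwise. -/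
def kroneckerSym (a n : ℤ) : ℤ :=
  if n = 0 then (if a.natAbs = 1 then 1 else 0)
  else (if n < 0 ∧ a < 0 then -1 else 1) *
    ZMod.χ₈ (a : ZMod 8) ^ (n.natAbs.factorization 2) *
    jacobiSym a (n.natAbs / 2 ^ (n.natAbs.factorization 2))

theorem kroneckerSym_natCast (a : ℤ) {n : ℕ} (hn : n ≠ 0) :
    kroneckerSym a n = ZMod.χ₈ (a : ZMod 8) ^ (n.factorization 2) *
      jacobiSym a (n / 2 ^ (n.factorization 2)) := by
  have h2 : ¬ ((n : ℤ) < 0 ∧ a < 0) := by omega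
  simp [kroneckerSym, hn]

theorem kroneckerSym_zero (a : ℤ) :
    kroneckerSym a ((0 : ℕ) : ℤ) = if a.natAbs = 1 then 1 else 0 := by
  simp [kroneckerSym]

theorem kroneckerSym_one_left (n : ℕ) : kroneckerSym 1 n = 1 := by
  rcases eq_or_ne n 0 with rfl | hn
  · simp [kroneckerSym]
  · rw [kroneckerSym_natCast _ hn]; simp

theorem kroneckerSym_mul {D : ℤ} (hD : D % 4 = 0 ∨ D % 4 = 1) (m n : ℕ) :
    kroneckerSym D ((m * n : ℕ) : ℤ) = kroneckerSym D m * kroneckerSym D n := by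
  by_cases h1 : D = 1
  · subst h1; simp only [kroneckerSym_one_left, mul_one]
  have h1' : D.natAbs ≠ 1 := by omega
  rcases eq_or_ne m 0 with rfl | hm
  · rw [Nat.zero_mul, kroneckerSym_zero, if_neg h1', zero_mul]
  rcases eq_or_ne n 0 with rfl | hn
  · rw [Nat.mul_zero, kroneckerSym_zero, if_neg h1', mul_zero]
  rw [kroneckerSym_natCast _ (mul_ne_zero hm hn), kroneckerSym_natCast _ hm,
    kroneckerSym_natCast _ hn, Nat.ordCompl_mul, Nat.factorization_mul hm hn,
    jacobiSym.mul_right' _ (Nat.ordCompl_pos 2 hm).ne' (Nat.ordCompl_pos 2 hn).ne',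
    Finsupp.add_apply, pow_add]
  ring

theorem chi8_even {D : ℤ} (h : D % 2 = 0) : ZMod.χ₈ (D : ZMod 8) = 0 := by
  rw [ZMod.χ₈_int_eq_if_mod_eight, if_pos h]

theorem chi8_natAbs (D : ℤ) : ZMod.χ₈ ((D.natAbs : ℕ) : ZMod 8) = ZMod.χ₈ (D : ZMod 8) := by
  have h := ZMod.χ₈_int_eq_if_mod_eight ((D.natAbs : ℕ) : ℤ)
  rw [Int.cast_natCast] at h
  rw [h, ZMod.χ₈_int_eq_if_mod_eight]
  split_ifs <;> first | rfl | omega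

theorem kroneckerSym_of_one_mod_four {D : ℤ} (hD : D % 4 = 1) (n : ℕ) :
    kroneckerSym D n = jacobiSym n D.natAbs := by
  have hodd : Odd D.natAbs := by rw [Nat.odd_iff]; omega
  have hrec : ∀ m : ℕ, Odd m → jacobiSym D m = jacobiSym m D.natAbs := by
    intro m hm
    rcases le_total 0 D with h0 | h0
    · have hDD : D = (D.natAbs : ℤ) := by omega
      conv_lhs => rw [hDD]
      exact jacobiSym.quadratic_reciprocity_one_mod_four (by omega) hm
    · have hDD : D = -1 * (D.natAbs : ℤ) := by omega
      have h3 : D.natAbs % 4 = 3 := by omega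
      conv_lhs => rw [hDD]
      rw [jacobiSym.mul_left, jacobiSym.at_neg_one hm]
      rcases Nat.odd_mod_four_iff.mp (Nat.odd_iff.mp hm) with hm4 | hm4
      · rw [ZMod.χ₄_nat_one_mod_four hm4, one_mul]
        exact (jacobiSym.quadratic_reciprocity_one_mod_four' hodd hm4)
      · rw [ZMod.χ₄_nat_three_mod_four hm4,
          jacobiSym.quadratic_reciprocity_three_mod_four h3 hm4]
        ring
  rcases eq_or_ne n 0 with rfl | hn
  · rw [kroneckerSym_zero]
    split_ifs with h
    · rw [h, jacobiSym.one_right]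
    · rw [Nat.cast_zero, jacobiSym.zero_left (by omega)]
  · have hm : Odd (n / 2 ^ (n.factorization 2)) := by
      rw [Nat.odd_iff]
      have := Nat.not_dvd_ordCompl Nat.prime_two hn
      omega
    rw [kroneckerSym_natCast _ hn, hrec _ hm]
    conv_rhs => rw [← Nat.ordProj_mul_ordCompl_eq_self n 2]
    rw [Nat.cast_mul, Nat.cast_pow, jacobiSym.mul_left, jacobiSym.pow_left, ← chi8_natAbs]
    congr 2
    exact (jacobiSym.at_two hodd).symm

theorem kroneckerSym_of_even {D : ℤ} (hD : D % 2 = 0) {n : ℕ} (hn : n % 2 = 0) :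
    kroneckerSym D n = 0 := by
  rcases eq_or_ne n 0 with rfl | h0
  · rw [kroneckerSym_zero, if_neg (by omega)]
  · rw [kroneckerSym_natCast _ h0, chi8_even hD, zero_pow, zero_mul]
    exact (Nat.prime_two.factorization_pos_of_dvd h0 (Nat.dvd_of_mod_eq_zero hn)).ne'

theorem kroneckerSym_of_odd (D : ℤ) {n : ℕ} (hn : n % 2 = 1) :
    kroneckerSym D n = jacobiSym D n := by
  have : n.factorization 2 = 0 := Nat.factorization_eq_zero_of_not_dvd (by omega)
  rw [kroneckerSym_natCast _ (by omega), this]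
  simp

/-- For `D ≡ 0, 1 mod 4`, the function `n ↦ (D / n)` has period `|D|`. -/
theorem kroneckerSym_mod {D : ℤ} (hD : D % 4 = 0 ∨ D % 4 = 1) (n : ℕ) :
    kroneckerSym D ((n % D.natAbs : ℕ) : ℤ) = kroneckerSym D n := by
  rcases hD with hD | hD
  · have h2 : n % D.natAbs % 2 = n % 2 :=
      Nat.mod_mod_of_dvd n (by omega)
    rcases Nat.mod_two_eq_zero_or_one n with hn | hn
    · rw [kroneckerSym_of_even (by omega) hn, kroneckerSym_of_even (by omega) (h2.trans hn)]
    · rw [kroneckerSym_of_odd _ hn, kroneckerSym_of_odd _ (h2.trans hn),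
        ← jacobiSym.div_four_left hD hn, ← jacobiSym.div_four_left hD (h2.trans hn),
        jacobiSym.mod_right (D / 4) (Nat.odd_iff.mpr hn)]
      have : 4 * (D / 4).natAbs = D.natAbs := by omega
      rw [this]
  · rw [kroneckerSym_of_one_mod_four hD, kroneckerSym_of_one_mod_four hD, Int.natCast_mod,
      ← jacobiSym.mod_left]

theorem kroneckerSym_eq_zero {D : ℤ} {n : ℕ} (h : ¬ n.Coprime D.natAbs) :
    kroneckerSym D n = 0 := by
  rcases eq_or_ne n 0 with rfl | h0
  · rw [kroneckerSym_zero, if_neg]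
    simpa using h
  obtain ⟨p, hp, hpn, hpD⟩ := Nat.Prime.not_coprime_iff_dvd.mp h
  rcases Nat.mod_two_eq_zero_or_one p with h2 | h2
  · have hp2 : p = 2 := (hp.eq_one_or_self_of_dvd 2 (Nat.dvd_of_mod_eq_zero h2)).resolve_left
      (by norm_num) |>.symm
    subst hp2
    exact kroneckerSym_of_even (by omega) (by omega)
  · rw [kroneckerSym_natCast _ h0, jacobiSym.eq_zero_iff.mpr, mul_zero]
    refine ⟨(Nat.ordCompl_pos 2 h0).ne', fun h1 => ?_⟩
    have hd : p ∣ n / 2 ^ (n.factorization 2) := by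
      have h3 : p ∣ 2 ^ (n.factorization 2) * (n / 2 ^ (n.factorization 2)) := by
        rwa [Nat.ordProj_mul_ordCompl_eq_self n 2]
      refine (Nat.Coprime.dvd_of_dvd_mul_left ?_ h3)
      refine Nat.Coprime.pow_right _ ?_
      exact (Nat.coprime_primes hp Nat.prime_two).mpr (by omega)
    have : p ∣ D.gcd ((n / 2 ^ (n.factorization 2) : ℕ) : ℤ) := by
      rw [Int.gcd, Int.natAbs_natCast]
      exact Nat.dvd_gcd hpD hd
    rw [h1] at this
    exact hp.one_lt.ne' (Nat.dvd_one.mp this)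

instance Int.neZero_natAbs (D : ℤ) [NeZero D] : NeZero D.natAbs :=
  ⟨Int.natAbs_ne_zero.mpr (NeZero.ne D)⟩

instance Int.neZero_four_mul (q : ℤ) [NeZero q] : NeZero (4 * q) :=
  ⟨mul_ne_zero (by norm_num) (NeZero.ne q)⟩

/-- For a nonzero integer `D ≡ 0, 1 mod 4`, the Dirichlet character of modulus `|D|` given by
the Kronecker symbol `n ↦ (D / n)`. -/
noncomputable def kroneckerChar (D : ℤ) [NeZero D] (hD : D % 4 = 0 ∨ D % 4 = 1) :
    DirichletCharacter ℂ D.natAbs where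
  toFun a := ((kroneckerSym D (a.val : ℤ) : ℤ) : ℂ)
  map_one' := by
    rw [← Nat.cast_one (R := ZMod D.natAbs), ZMod.val_natCast, kroneckerSym_mod hD,
      kroneckerSym_natCast _ one_ne_zero]
    simp
  map_mul' a b := by
    rw [ZMod.val_mul, kroneckerSym_mod hD, kroneckerSym_mul hD, Int.cast_mul]
  map_nonunit' a ha := by
    have h : ¬ a.val.Coprime D.natAbs := fun h => ha (by
      have := (ZMod.isUnit_iff_coprime a.val D.natAbs).mpr h
      rwa [ZMod.natCast_zmod_val] at this)
    rw [kroneckerSym_eq_zero h, Int.cast_zero]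

theorem kroneckerChar_natCast (D : ℤ) [NeZero D] (hD : D % 4 = 0 ∨ D % 4 = 1) (n : ℕ) :
    kroneckerChar D hD (n : ZMod D.natAbs) = ((kroneckerSym D (n : ℤ) : ℤ) : ℂ) := by
  change ((kroneckerSym D ((n : ZMod D.natAbs).val : ℤ) : ℤ) : ℂ) = _
  rw [ZMod.val_natCast, kroneckerSym_mod hD]

theorem four_mul_disc (q : ℤ) : 4 * q % 4 = 0 ∨ 4 * q % 4 = 1 := by omega

theorem disc_of_five_mod_eight {q : ℤ} (h : q ≡ 5 [ZMOD 8]) : q % 4 = 0 ∨ q % 4 = 1 := by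
  unfold Int.ModEq at h
  omega

theorem disc_of_one_mod_eight {q : ℤ} (h : q ≡ 1 [ZMOD 8]) : q % 4 = 0 ∨ q % 4 = 1 := by
  unfold Int.ModEq at h
  omega

/-! Sort the pairs by their larger element `b`. Once `b > |q|`, the solutions of `a b + q = r²` with
`1 ≤ a < b` correspond to the `r` in `[0, b)` with `r² ≡ q (mod b)`. So, up to a bounded error, the
count is `∑_{b ≤ N} ρ(b)`, where `ρ(b)` is the number of square roots of `q` modulo `b`
(`card_filter_isSquare_eq_sqrtCount`).

By the Chinese remainder theorem `ρ` is multiplicative. At every odd prime its Euler factor is that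
of `ζ(s) L(s, χ) / ζ(2s)`, namely `(1 + p⁻ˢ) / (1 - χ(p) p⁻ˢ)`. At 2 the two differ by a polynomial
`1 + u 2⁻ˢ + v 4⁻ˢ`, with `(u, v) = (0, 0), (1, 2), (-1, 2)` for `q ≡ 3 (mod 4)`, `5 (mod 8)`, `1
(mod 8)`. Hence `ρ` is exactly the convolution of this polynomial with `χ * μ²`
(`sqrtCount_eq_dyadicFactor_mul`).

The sum of `χ * μ²` up to `N` is `∑ χ(m) Q(N / m)`, where `Q(n) ∼ n / ζ(2)` counts squarefree
numbers. Since `χ` has bounded partial sums and `Q` is monotone, Abel summation makes the large `m`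
negligible and the mean value is `L(1, χ) / ζ(2)` (`tendsto_sum_mul_div_of_monotone`). The
polynomial multiplies it by its value at `s = 1`, `1 + u/2 + v/4`, which is 1, 2, 1 in the three
cases. As `L(1, χ) ≠ 0`, this limit is an asymptotic equivalence. -/

section CharacterSums

/-! ### Abel summation against bounded partial sums -/

/-- Abel summation bound for a nonnegative weight that is antitone on `[a, b]`. -/
theorem norm_sum_Ico_smul_le_of_antitone {f : ℕ → ℝ} {g : ℕ → ℂ} {B : ℝ} {a b : ℕ} (hab : a ≤ b)
    (hf : ∀ i, a ≤ i → f (i + 1) ≤ f i) (hf0 : ∀ i, 0 ≤ f i)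
    (hg : ∀ n, ‖∑ i ∈ Finset.range n, g i‖ ≤ B) :
    ‖∑ i ∈ Finset.Ico a b, (f i : ℂ) * g i‖ ≤ 2 * B * f a := by
  set S : ℕ → ℂ := fun n => ∑ i ∈ Finset.range n, g i with hS
  have hdiff : ∀ m n, ‖S m - S n‖ ≤ 2 * B := fun m n =>
    (norm_sub_le _ _).trans (by linarith [hg m, hg n])
  -- With the boundary term subtracted, each induction step adds only `(f n - f (n + 1)) (S (n + 1)
  -- - S a)`, so the bound telescopes.
  have key : ∀ b, a ≤ b →
      ‖∑ i ∈ Finset.Ico a b, (f i : ℂ) * g i - f b * (S b - S a)‖ ≤ 2 * B * (f a - f b) := by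
    intro b hab
    induction b, hab using Nat.le_induction with
    | base => simp
    | succ n hn ih =>
      have hg' : g n = S (n + 1) - S n := by simp [hS, Finset.sum_range_succ]
      have e : ∑ i ∈ Finset.Ico a (n + 1), (f i : ℂ) * g i - f (n + 1) * (S (n + 1) - S a) =
          (∑ i ∈ Finset.Ico a n, (f i : ℂ) * g i - f n * (S n - S a)) +
            ((f n - f (n + 1) : ℝ) : ℂ) * (S (n + 1) - S a) := by
        rw [Finset.sum_Ico_succ_top hn, hg']
        push_cast
        ring
      rw [e]
      refine (norm_add_le _ _).trans ?_
      rw [norm_mul, Complex.norm_real, Real.norm_of_nonneg (by linarith [hf n hn])]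
      nlinarith [mul_le_mul_of_nonneg_left (hdiff (n + 1) a)
        (show 0 ≤ f n - f (n + 1) by linarith [hf n hn])]
  have h1 := key b hab
  have h2 : ‖(f b : ℂ) * (S b - S a)‖ ≤ 2 * B * f b := by
    rw [norm_mul, Complex.norm_real, Real.norm_of_nonneg (hf0 b), mul_comm]
    exact mul_le_mul_of_nonneg_right (hdiff b a) (hf0 b)
  calc _ = ‖(∑ i ∈ Finset.Ico a b, (f i : ℂ) * g i - f b * (S b - S a)) + f b * (S b - S a)‖ := by
        rw [sub_add_cancel]
    _ ≤ 2 * B * (f a - f b) + 2 * B * f b := (norm_add_le _ _).trans (add_le_add h1 h2)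
    _ = _ := by ring

/-- The partial sums of a nontrivial Dirichlet character are bounded. -/
theorem DirichletCharacter.exists_norm_sum_range_le {M : ℕ} [NeZero M]
    {χ : DirichletCharacter ℂ M} (hχ : χ ≠ 1) :
    ∃ B : ℝ, ∀ n, ‖∑ i ∈ Finset.range n, χ (i : ZMod M)‖ ≤ B := by
  have hper : ∑ i ∈ Finset.range M, χ (i : ZMod M) = 0 := by
    rw [← MulChar.sum_eq_zero_of_ne_one hχ]
    refine Finset.sum_bij' (fun i _ => (i : ZMod M)) (fun a _ => a.val) ?_ ?_ ?_ ?_ ?_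
    · simp
    · simp [ZMod.val_lt]
    · intro i hi
      exact ZMod.val_cast_of_lt (Finset.mem_range.mp hi)
    · simp
    · simp
  have hmul : ∀ k, ∑ i ∈ Finset.range (M * k), χ (i : ZMod M) = 0 := by
    intro k
    induction k with
    | zero => simp
    | succ k ih =>
      rw [mul_add, mul_one, Finset.sum_range_add, ih, zero_add, ← hper]
      simp
  refine ⟨M, fun n => ?_⟩
  rw [← Nat.div_add_mod n M, Finset.sum_range_add, hmul, zero_add]
  refine (norm_sum_le_of_le _ (fun i _ => χ.norm_le_one _)).trans ?_
  simpa using (Nat.mod_lt n (NeZero.pos M)).le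

/-- **Dirichlet's test** for `∑ g(m) / m`. -/
theorem exists_tendsto_sum_div {g : ℕ → ℂ} {B : ℝ}
    (hg : ∀ n, ‖∑ i ∈ Finset.range n, g i‖ ≤ B) :
    ∃ L, Tendsto (fun n : ℕ => ∑ m ∈ Finset.range n, g m / m) atTop (nhds L) := by
  refine cauchySeq_tendsto_of_complete (Metric.cauchySeq_iff'.mpr fun ε hε => ?_)
  have hB : 0 ≤ B := (norm_nonneg _).trans (hg 0)
  have h0 : Tendsto (fun n : ℕ => 2 * B * (1 / (n : ℝ))) atTop (nhds 0) := by
    simpa using (tendsto_one_div_atTop_nhds_zero_nat (𝕜 := ℝ)).const_mul (2 * B)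
  obtain ⟨N, hN, hN1⟩ := ((h0.eventually_lt_const hε).and (eventually_ge_atTop 1)).exists
  refine ⟨N, fun n hn => ?_⟩
  rw [dist_eq_norm, ← Finset.sum_Ico_eq_sub _ hn]
  refine lt_of_le_of_lt ?_ hN
  have := norm_sum_Ico_smul_le_of_antitone (f := fun i => 1 / (i : ℝ)) hn (fun i hi => ?_)
    (fun i => by positivity) hg
  · refine le_of_eq_of_le ?_ this
    congr 1
    refine Finset.sum_congr rfl fun i _ => ?_
    push_cast
    ring
  · have : (0 : ℝ) < i := by exact_mod_cast (by omega : 0 < i)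
    push_cast
    exact one_div_le_one_div_of_le this (by linarith)

/-- The quotient `⌊N / k⌋ / N` tends to `1 / k`. The case `k = 0` holds through `N / 0 = 0` and `c /
0 = 0`, which allows sums over `range` to be treated termwise. -/
theorem tendsto_natCast_div_div {F : ℕ → ℂ} {c : ℂ}
    (hF : Tendsto (fun N : ℕ => F N / N) atTop (nhds c)) (k : ℕ) :
    Tendsto (fun N : ℕ => F (N / k) / N) atTop (nhds (c / k)) := by
  rcases eq_or_ne k 0 with rfl | hk
  · simpa [div_eq_mul_inv] using (tendsto_inv_atTop_nhds_zero_nat (𝕜 := ℂ)).const_mul (F 0)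
  have h1 : Tendsto (fun N : ℕ => N / k) atTop atTop := Nat.tendsto_div_const_atTop hk
  have h2 : Tendsto (fun N : ℕ => (((N / k : ℕ) : ℝ) / N : ℝ)) atTop (nhds (1 / k)) := by
    have h3 : Tendsto (fun N : ℕ => (⌊(1 / k : ℝ) * N⌋₊ : ℝ) / N) atTop (nhds (1 / k)) :=
      (tendsto_nat_floor_mul_div_atTop (R := ℝ) (by positivity)).comp tendsto_natCast_atTop_atTop
    refine h3.congr fun N => ?_
    rw [one_div, inv_mul_eq_div, Nat.floor_div_natCast, Nat.floor_natCast]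
  have h4 := (hF.comp h1).mul (Complex.continuous_ofReal.tendsto _ |>.comp h2)
  rw [show c * ((1 / k : ℝ) : ℂ) = c / k by push_cast; ring] at h4
  refine h4.congr' ?_
  filter_upwards [h1.eventually_ge_atTop 1] with N hN
  have h5 : ((N / k : ℕ) : ℂ) ≠ 0 := by exact_mod_cast (by omega : N / k ≠ 0)
  simp only [Function.comp_apply]
  push_cast
  rw [div_mul_div_comm, mul_comm, mul_div_mul_left _ _ h5]

/-- If `g` has bounded partial sums and `F(N) ∼ c N` is monotone then
`∑_{m ≤ N} g(m) F(N / m) ∼ c (∑ g(m) / m) N`. -/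
theorem tendsto_sum_mul_div_of_monotone {g : ℕ → ℂ} {B : ℝ} {L : ℂ} {F : ℕ → ℝ} {c : ℝ}
    (hg : ∀ n, ‖∑ i ∈ Finset.range n, g i‖ ≤ B)
    (hL : Tendsto (fun n : ℕ => ∑ m ∈ Finset.range n, g m / m) atTop (nhds L))
    (hFm : Monotone F) (hF0 : F 0 = 0) (hF : Tendsto (fun N : ℕ => F N / N) atTop (nhds c)) :
    Tendsto (fun N : ℕ => (∑ m ∈ Finset.Ioc 0 N, g m * F (N / m)) / N) atTop
      (nhds (c * L)) := by
  have hB : 0 ≤ B := (norm_nonneg _).trans (hg 0)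
  have hFp : ∀ n, 0 ≤ F n := fun n => hF0 ▸ hFm (Nat.zero_le n)
  obtain ⟨C, hC⟩ : ∃ C, ∀ N : ℕ, F N / N ≤ C := by
    obtain ⟨C, hC⟩ := hF.bddAbove_range
    exact ⟨C, fun N => hC ⟨N, rfl⟩⟩
  have hC0 : 0 ≤ C := (div_nonneg (hFp 0) (by simp)).trans (hC 0)
  have hFC : ∀ N : ℕ, F N ≤ C * N := fun N => by
    rcases Nat.eq_zero_or_pos N with rfl | h
    · simp [hF0]
    · exact (div_le_iff₀ (by exact_mod_cast h)).mp (hC N)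
  rw [Metric.tendsto_atTop]
  intro ε hε
  have h0 : Tendsto (fun n : ℕ => 2 * B * C * (1 / (n : ℝ))) atTop (nhds 0) := by
    simpa using (tendsto_one_div_atTop_nhds_zero_nat (𝕜 := ℝ)).const_mul (2 * B * C)
  have hcL := Metric.tendsto_atTop.mp (hL.const_mul (c : ℂ)) (ε / 3) (by positivity)
  obtain ⟨K₀, hK₀⟩ := hcL
  -- The cutoff `K` is chosen before `N`: it makes both the tail bound `2BC / K` and the error of
  -- the truncated series smaller than `ε / 3`.
  obtain ⟨K, hK, hK1⟩ := ((h0.eventually_lt_const (show 0 < ε / 3 by positivity)).and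
    (eventually_ge_atTop (max 1 K₀))).exists
  have hFc : Tendsto (fun N : ℕ => (F N : ℂ) / N) atTop (nhds (c : ℂ)) := by
    refine (Complex.continuous_ofReal.tendsto c |>.comp hF).congr fun N => ?_
    simp
  have hmain : Tendsto (fun N : ℕ => ∑ m ∈ Finset.range K, g m * ((F (N / m) : ℂ) / N)) atTop
      (nhds (c * ∑ m ∈ Finset.range K, g m / m)) := by
    rw [Finset.mul_sum]
    refine tendsto_finsetSum _ fun m _ => ?_
    rw [show (c : ℂ) * (g m / m) = g m * (c / m) by ring]
    exact (tendsto_natCast_div_div (F := fun n => (F n : ℂ)) hFc m).const_mul (g m)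
  obtain ⟨N₀, hN₀⟩ := Metric.tendsto_atTop.mp hmain (ε / 3) (by positivity)
  refine ⟨max N₀ K, fun N hN => ?_⟩
  have hKN : K ≤ N := (le_max_right _ _).trans hN
  have hN1 : 1 ≤ N := by omega
  have hNpos : (0 : ℝ) < N := by exact_mod_cast hN1
  have hsplit : (∑ m ∈ Finset.Ioc 0 N, g m * F (N / m)) / (N : ℂ) =
      ∑ m ∈ Finset.range K, g m * ((F (N / m) : ℂ) / N) +
        (∑ m ∈ Finset.Ico K (N + 1), (F (N / m) : ℂ) * g m) / N := by
    have e : ∑ m ∈ Finset.Ioc 0 N, g m * (F (N / m) : ℂ) =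
        ∑ m ∈ Finset.range (N + 1), g m * (F (N / m) : ℂ) := by
      rw [Finset.sum_range_eq_add_Ico _ (Nat.succ_pos N)]
      simp only [Nat.div_zero, hF0, Complex.ofReal_zero, mul_zero, zero_add]
      rfl
    rw [e, ← Finset.sum_range_add_sum_Ico _ (show K ≤ N + 1 by omega), add_div, Finset.sum_div]
    congr 1
    · exact Finset.sum_congr rfl fun m _ => by ring
    · congr 1
      exact Finset.sum_congr rfl fun m _ => by ring
  -- For fixed `N` the weight `m ↦ F (N / m)` is antitone from `K ≥ 1` on, so the tail is at most
  -- `2B F (N / K) ≤ 2BC N / K`, uniformly in `N`.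
  have htail : ‖(∑ m ∈ Finset.Ico K (N + 1), (F (N / m) : ℂ) * g m) / N‖ < ε / 3 := by
    have h1 := norm_sum_Ico_smul_le_of_antitone (f := fun m => F (N / m))
      (show K ≤ N + 1 by omega)
      (fun i hi => hFm (Nat.div_le_div_left (Nat.le_succ i) (by omega))) (fun i => hFp _) hg
    rw [norm_div, Complex.norm_natCast]
    refine lt_of_le_of_lt ?_ hK
    rw [div_le_iff₀ hNpos]
    refine h1.trans ?_
    have h2 : F (N / K) ≤ C * (N / K) :=
      (hFC _).trans (mul_le_mul_of_nonneg_left Nat.cast_div_le hC0)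
    calc 2 * B * F (N / K) ≤ 2 * B * (C * (N / K)) :=
          mul_le_mul_of_nonneg_left h2 (by positivity)
      _ = _ := by ring
  have h1 := hN₀ N ((le_max_left _ _).trans hN)
  have h2 := hK₀ K ((le_max_right _ _).trans hK1)
  rw [hsplit, dist_eq_norm]
  rw [dist_eq_norm] at h1 h2
  set A := ∑ m ∈ Finset.range K, g m * ((F (N / m) : ℂ) / N)
  set T := (∑ m ∈ Finset.Ico K (N + 1), (F (N / m) : ℂ) * g m) / (N : ℂ)
  set P := (c : ℂ) * ∑ m ∈ Finset.range K, g m / m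
  calc ‖A + T - c * L‖ = ‖(A - P) + (P - c * L) + T‖ := by congr 1; ring
    _ ≤ ‖A - P‖ + ‖P - c * L‖ + ‖T‖ :=
      (norm_add_le _ _).trans (add_le_add_left (norm_add_le _ _) _)
    _ < ε := by linarith

/-! ### The series `∑ χ(m) / m` and `L(1, χ)` -/

theorem DirichletCharacter.toArithmeticFunction_apply {M : ℕ} (χ : DirichletCharacter ℂ M) {n : ℕ}
    (hn : n ≠ 0) : toArithmeticFunction (fun n : ℕ => χ n) n = χ n :=
  (DirichletCharacter.apply_eq_toArithmeticFunction_apply χ hn).symm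

open ArithmeticFunction in
theorem DirichletCharacter.LSeries_zetaMul {M : ℕ} [NeZero M] (χ : DirichletCharacter ℂ M) {s : ℂ}
    (hs : 1 < s.re) : LSeries χ.zetaMul s = riemannZeta s * χ.LFunction s := by
  have hχ : ∀ {n : ℕ}, n ≠ 0 → toArithmeticFunction (fun n : ℕ => χ n) n = χ n :=
    χ.toArithmeticFunction_apply
  have hs1 : LSeriesSummable (fun n => ((zeta : ArithmeticFunction ℕ) : ArithmeticFunction ℂ) n) s :=
    (LSeriesSummable_zeta_iff (s := s)).mpr hs
  have hs2 : LSeriesSummable (fun n => toArithmeticFunction (fun n : ℕ => χ n) n) s :=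
    (LSeriesSummable_congr s hχ).mpr (χ.LSeriesSummable_of_one_lt_re hs)
  have hz : LSeries (fun n => ((zeta : ArithmeticFunction ℕ) : ArithmeticFunction ℂ) n) s =
      riemannZeta s := LSeries_zeta_eq_riemannZeta hs
  have hL : LSeries (fun n => toArithmeticFunction (fun n : ℕ => χ n) n) s = χ.LFunction s := by
    rw [χ.LFunction_eq_LSeries hs]
    exact LSeries_congr hχ s
  rw [← hz, ← hL]
  exact LSeries_mul' hs1 hs2

open ArithmeticFunction in
theorem DirichletCharacter.sum_zetaMul {M : ℕ} (χ : DirichletCharacter ℂ M) (N : ℕ) :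
    ∑ k ∈ Finset.Icc 1 N, χ.zetaMul k =
      ∑ m ∈ Finset.Ioc 0 N, χ (m : ZMod M) * (((N / m : ℕ) : ℝ) : ℂ) := by
  have := sum_Ioc_mul_zeta_eq_sum (toArithmeticFunction (fun n : ℕ => χ n)) N
  rw [zetaMul, mul_comm, show Finset.Icc 1 N = Finset.Ioc 0 N from rfl, this]
  refine Finset.sum_congr rfl fun m hm => ?_
  have hm0 : m ≠ 0 := by have := Finset.mem_Ioc.mp hm; omega
  rw [χ.toArithmeticFunction_apply hm0, Complex.ofReal_natCast]

/-- For a nontrivial Dirichlet character, `∑ χ(m) / m` converges to `L(1, χ)`. -/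
theorem DirichletCharacter.tendsto_sum_div_LFunction_one {M : ℕ} [NeZero M]
    {χ : DirichletCharacter ℂ M} (hχ : χ ≠ 1) :
    Tendsto (fun n : ℕ => ∑ m ∈ Finset.range n, χ (m : ZMod M) / m) atTop
      (nhds (χ.LFunction 1)) := by
  obtain ⟨B, hB⟩ := χ.exists_norm_sum_range_le hχ
  obtain ⟨L, hL⟩ := exists_tendsto_sum_div hB
  suffices h : L = χ.LFunction 1 by rwa [← h]
  -- Taking `F(n) = n` shows that `1 * χ` has mean value `L`. The Abelian theorem then gives `(s -
  -- 1) ζ(s) L(s, χ) → L` as `s → 1⁺`, while the simple pole of `ζ` and continuity of `L(s, χ)` give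
  -- the limit `L(1, χ)`.
  have h1 := tendsto_sum_mul_div_of_monotone hB hL (F := fun n => (n : ℝ)) (c := 1)
    Nat.mono_cast (by simp) (tendsto_const_nhds.congr' (by
      filter_upwards [eventually_ge_atTop 1] with n hn
      rw [div_self (by positivity)]))
  rw [Complex.ofReal_one, one_mul] at h1
  have h2 : Tendsto (fun n : ℕ => (∑ k ∈ Finset.Icc 1 n, χ.zetaMul k) / n) atTop (nhds L) :=
    h1.congr fun N => by rw [χ.sum_zetaMul]
  have h3 := LSeries_tendsto_sub_mul_nhds_one_of_tendsto_sum_div h2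
    (fun s hs => χ.LSeriesSummable_zetaMul (by rwa [Complex.ofReal_re]))
  have hcast : Tendsto (fun s : ℝ => (s : ℂ)) (nhdsWithin 1 (Set.Ioi 1)) (nhdsWithin 1 {1}ᶜ) := by
    refine tendsto_nhdsWithin_iff.mpr ⟨?_, ?_⟩
    · exact (Complex.continuous_ofReal.tendsto 1).mono_left nhdsWithin_le_nhds
    · filter_upwards [self_mem_nhdsWithin] with s hs
      have : (s : ℝ) ≠ 1 := ne_of_gt hs
      simpa using this
  have h4 := (riemannZeta_residue_one.comp hcast).mul
    (((χ.differentiableAt_LFunction 1 (Or.inr hχ)).continuousAt.tendsto.mono_left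
      nhdsWithin_le_nhds).comp hcast)
  rw [one_mul] at h4
  refine tendsto_nhds_unique h3 (h4.congr' ?_)
  filter_upwards [self_mem_nhdsWithin] with s hs
  have hs' : 1 < (s : ℂ).re := by rwa [Complex.ofReal_re]
  simp only [Function.comp_apply]
  rw [χ.LSeries_zetaMul hs', mul_assoc]

/-! ### Density of the squarefree numbers -/

/-- The indicator function of the squarefree numbers as a divisor sum. -/
theorem moebius_sq_eq_sum {n N : ℕ} (hn : n ≠ 0) (hN : n ≤ N) :
    (ArithmeticFunction.moebius n) ^ 2 =
      ∑ d ∈ Finset.Ioc 0 N with d ^ 2 ∣ n, ArithmeticFunction.moebius d := by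
  obtain ⟨a, b, ha, hb, rfl, hsq⟩ := Nat.sq_mul_squarefree_of_pos (Nat.pos_of_ne_zero hn)
  -- With `n = b² a` and `a` squarefree, `d² ∣ n` exactly when `d ∣ b`: after removing `gcd(d, b)`,
  -- the square of what is left of `d` divides `a`. The sum is therefore `∑_{d ∣ b} μ(d)`, which
  -- detects `b = 1`.
  have hset : (Finset.Ioc 0 N).filter (fun d => d ^ 2 ∣ b ^ 2 * a) = b.divisors := by
    ext d
    simp only [Finset.mem_filter, Finset.mem_Ioc, Nat.mem_divisors]
    constructor
    · rintro ⟨⟨hd, -⟩, hdvd⟩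
      refine ⟨?_, hb.ne'⟩
      obtain ⟨g, d', b', hg, hco, rfl, rfl⟩ := Nat.exists_coprime' (Nat.gcd_pos_of_pos_left b hd)
      rw [mul_pow, mul_pow, mul_right_comm] at hdvd
      have h1 := Nat.dvd_of_mul_dvd_mul_right (by positivity) hdvd
      have h2 : d' ^ 2 ∣ a := (Nat.Coprime.pow 2 2 hco).dvd_of_dvd_mul_left h1
      rw [sq] at h2
      rw [Nat.isUnit_iff.mp (hsq d' h2), one_mul]
      exact Dvd.intro_left _ rfl
    · rintro ⟨hd, -⟩
      refine ⟨⟨Nat.pos_of_dvd_of_pos hd hb, ?_⟩, (pow_dvd_pow_of_dvd hd 2).mul_right a⟩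
      calc d ≤ b := Nat.le_of_dvd hb hd
        _ ≤ b ^ 2 * a := by nlinarith
        _ ≤ N := hN
  rw [hset, ← ArithmeticFunction.coe_mul_zeta_apply, ArithmeticFunction.moebius_mul_coe_zeta,
    ArithmeticFunction.one_apply, ArithmeticFunction.moebius_sq]
  congr 1
  refine propext ⟨fun h => ?_, fun h => by simpa [h] using hsq⟩
  have := h b ⟨a, by ring⟩
  exact Nat.isUnit_iff.mp this

theorem sum_moebius_sq (N : ℕ) :
    ∑ n ∈ Finset.Ioc 0 N, (ArithmeticFunction.moebius n) ^ 2 =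
      ∑ d ∈ Finset.Ioc 0 N, ArithmeticFunction.moebius d * ((N / d ^ 2 : ℕ) : ℤ) := by
  have h : ∀ n ∈ Finset.Ioc 0 N, (ArithmeticFunction.moebius n) ^ 2 =
      ∑ d ∈ Finset.Ioc 0 N, if d ^ 2 ∣ n then ArithmeticFunction.moebius d else 0 := by
    intro n hn
    rw [Finset.mem_Ioc] at hn
    rw [moebius_sq_eq_sum (by omega) hn.2, Finset.sum_filter]
  rw [Finset.sum_congr rfl h, Finset.sum_comm]
  refine Finset.sum_congr rfl fun d _ => ?_
  rw [← Finset.sum_filter, Finset.sum_const, ← Nat.Ioc_filter_dvd_card_eq_div, nsmul_eq_mul,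
    mul_comm]

/-- The squarefree numbers have density `1 / ζ(2)`. -/
theorem tendsto_sum_moebius_sq_div :
    Tendsto (fun N : ℕ => (∑ n ∈ Finset.Ioc 0 N, ((ArithmeticFunction.moebius n : ℤ) : ℂ) ^ 2) / N)
      atTop (nhds (1 / riemannZeta 2)) := by
  have hζ : 1 / riemannZeta 2 = ∑' d : ℕ, ((ArithmeticFunction.moebius d : ℤ) : ℂ) * (1 / d ^ 2) := by
    have h2 : 1 < (2 : ℂ).re := by norm_num
    have h := ArithmeticFunction.LSeries_zeta_mul_Lseries_moebius h2
    rw [ArithmeticFunction.LSeries_zeta_eq_riemannZeta h2] at h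
    rw [one_div, ← eq_inv_of_mul_eq_one_right h, LSeries]
    refine tsum_congr fun d => ?_
    rcases eq_or_ne d 0 with rfl | hd
    · simp
    · rw [LSeries.term_of_ne_zero hd, mul_one_div, ← Nat.cast_ofNat (R := ℂ), Complex.cpow_natCast]
  rw [hζ]
  -- The terms `μ(d) ⌊N / d²⌋ / N` are dominated by `1 / d²`, so the limit may be taken termwise.
  have hlim := tendsto_tsum_of_dominated_convergence (𝓕 := atTop) (bound := fun d : ℕ => 1 / (d : ℝ) ^ 2)
    (f := fun (N d : ℕ) => ((ArithmeticFunction.moebius d : ℤ) : ℂ) * (((N / d ^ 2 : ℕ) : ℂ) / N))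
    (g := fun d : ℕ => ((ArithmeticFunction.moebius d : ℤ) : ℂ) * (1 / d ^ 2))
    (Real.summable_one_div_nat_pow.mpr one_lt_two) (fun d => ?_) (Eventually.of_forall fun N d => ?_)
  · refine hlim.congr fun N => ?_
    rw [tsum_eq_sum (s := Finset.Ioc 0 N), Finset.sum_div]
    · have := congrArg (fun z : ℤ => (z : ℂ) / N) (sum_moebius_sq N)
      simp only [Int.cast_sum, Int.cast_mul, Int.cast_pow, Int.cast_natCast] at this
      rw [← Finset.sum_div, this, Finset.sum_div]
      refine Finset.sum_congr rfl fun d _ => ?_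
      rw [mul_div_assoc]
    · intro d hd
      have : N / d ^ 2 = 0 := by
        rcases Nat.eq_zero_or_pos d with rfl | h0
        · simp
        · have : N < d := by simpa [h0] using hd
          exact Nat.div_eq_of_lt (by nlinarith)
      simp [this]
  · refine Tendsto.const_mul _ ?_
    have := tendsto_natCast_div_div (F := fun n => (n : ℂ)) (c := 1)
      (tendsto_const_nhds.congr' (by
        filter_upwards [eventually_ge_atTop 1] with n hn
        rw [div_self (by exact_mod_cast (by omega : n ≠ 0))])) (d ^ 2)
    exact_mod_cast this
  · rw [norm_mul, norm_div, Complex.norm_natCast, Complex.norm_natCast, Complex.norm_intCast]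
    have h1 : |((ArithmeticFunction.moebius d : ℤ) : ℝ)| ≤ 1 := by
      exact_mod_cast ArithmeticFunction.abs_moebius_le_one
    have h2 : ((N / d ^ 2 : ℕ) : ℝ) / N ≤ 1 / d ^ 2 := by
      rcases Nat.eq_zero_or_pos N with rfl | hN
      · simp
      · rw [div_le_iff₀ (by exact_mod_cast hN), one_div_mul_eq_div]
        exact_mod_cast Nat.cast_div_le (α := ℝ) (m := N) (n := d ^ 2)
    calc _ ≤ 1 * (1 / (d : ℝ) ^ 2) := mul_le_mul h1 h2 (by positivity) zero_le_one
      _ = _ := one_mul _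

end CharacterSums

/-! ### The convolution `χ * μ²` and the correction at 2 -/

section Convolutions

/-- The arithmetic function `μ ^ 2 * χ`, whose Dirichlet series is `ζ(s) L(s, χ) / ζ(2s)`. -/
noncomputable def DirichletCharacter.squarefreeMul {M : ℕ} (χ : DirichletCharacter ℂ M) :
    ArithmeticFunction ℂ :=
  toArithmeticFunction (fun n : ℕ => χ n) *
    ((ArithmeticFunction.moebius : ArithmeticFunction ℂ).ppow 2)

/-- The arithmetic function with Dirichlet series `1 + u 2⁻ˢ + v 4⁻ˢ`. -/
def dyadicFactor (u v : ℂ) : ArithmeticFunction ℂ where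
  toFun n := if n = 1 then 1 else if n = 2 then u else if n = 4 then v else 0
  map_zero' := by simp

theorem dyadicFactor_apply (u v : ℂ) (n : ℕ) :
    dyadicFactor u v n = if n = 1 then 1 else if n = 2 then u else if n = 4 then v else 0 := rfl

theorem DirichletCharacter.isMultiplicative_squarefreeMul {M : ℕ} (χ : DirichletCharacter ℂ M) :
    χ.squarefreeMul.IsMultiplicative :=
  (DirichletCharacter.isMultiplicative_toArithmeticFunction χ).mul
    (ArithmeticFunction.isMultiplicative_moebius.intCast.ppow)

theorem isMultiplicative_dyadicFactor (u v : ℂ) : (dyadicFactor u v).IsMultiplicative := by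
  rw [ArithmeticFunction.IsMultiplicative.iff_ne_zero]
  refine ⟨by simp [dyadicFactor_apply], ?_⟩
  -- Two coprime numbers other than 0 and 1 are not both even, and their product is at least 6; so
  -- both sides of multiplicativity vanish.
  have h0 : ∀ m n : ℕ, m.Coprime n → m ≠ 0 → n ≠ 0 → m ≠ 1 → n ≠ 1 →
      m * n ≠ 1 ∧ m * n ≠ 2 ∧ m * n ≠ 4 ∧ ((m ≠ 2 ∧ m ≠ 4) ∨ (n ≠ 2 ∧ n ≠ 4)) := by
    intro m n h hm0 hn0 hm hn
    have h22 : ¬ (2 ∣ m ∧ 2 ∣ n) := fun ⟨h1, h2⟩ => by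
      have := Nat.dvd_gcd h1 h2
      rw [h] at this
      omega
    have h2 : 2 ≤ m := by omega
    have h3 : 2 ≤ n := by omega
    have h4 : 6 ≤ m * n := by
      rcases (by omega : 3 ≤ m ∨ 3 ≤ n) with h | h <;> nlinarith
    omega
  intro m n hm0 hn0 h
  by_cases hm : m = 1
  · simp [hm, dyadicFactor_apply]
  by_cases hn : n = 1
  · simp [hn, dyadicFactor_apply]
  obtain ⟨h1, h2, h4, h5 | h5⟩ := h0 m n h hm0 hn0 hm hn
  · simp only [dyadicFactor_apply, if_neg h1, if_neg h2, if_neg h4, if_neg hm, if_neg h5.1,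
      if_neg h5.2, zero_mul]
  · simp only [dyadicFactor_apply, if_neg h1, if_neg h2, if_neg h4, if_neg hn, if_neg h5.1,
      if_neg h5.2, mul_zero]

theorem DirichletCharacter.tendsto_sum_squarefreeMul_div {M : ℕ} [NeZero M]
    {χ : DirichletCharacter ℂ M} (hχ : χ ≠ 1) :
    Tendsto (fun N : ℕ => (∑ n ∈ Finset.Ioc 0 N, χ.squarefreeMul n) / N) atTop
      (nhds (χ.LFunction 1 / riemannZeta 2)) := by
  set F : ℕ → ℝ := fun N => ∑ n ∈ Finset.Ioc 0 N, ((ArithmeticFunction.moebius n : ℤ) : ℝ) ^ 2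
    with hF
  have hFlim : Tendsto (fun N : ℕ => ((F N / N : ℝ) : ℂ)) atTop (nhds (1 / riemannZeta 2)) := by
    refine tendsto_sum_moebius_sq_div.congr fun N => ?_
    simp [hF]
  have hFre : Tendsto (fun N : ℕ => F N / N) atTop (nhds (1 / riemannZeta 2).re) :=
    ((Complex.continuous_re.tendsto _).comp hFlim).congr fun N => Complex.ofReal_re _
  -- `1 / ζ(2)` is real because it is a limit of real numbers.
  have hc : ((1 / riemannZeta 2).re : ℂ) = 1 / riemannZeta 2 :=
    tendsto_nhds_unique ((Complex.continuous_ofReal.tendsto _).comp hFre) hFlim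
  have hmono : Monotone F := fun a b hab =>
    Finset.sum_le_sum_of_subset_of_nonneg (Finset.Ioc_subset_Ioc_right hab)
      fun _ _ _ => sq_nonneg _
  obtain ⟨B, hB⟩ := χ.exists_norm_sum_range_le hχ
  have h := tendsto_sum_mul_div_of_monotone hB (χ.tendsto_sum_div_LFunction_one hχ) hmono
    (by simp [hF]) hFre
  rw [hc, one_div_mul_eq_div] at h
  refine h.congr fun N => ?_
  rw [DirichletCharacter.squarefreeMul, ArithmeticFunction.sum_Ioc_mul_eq_sum_sum]
  congr 1
  refine Finset.sum_congr rfl fun m hm => ?_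
  have hm0 : m ≠ 0 := by have := Finset.mem_Ioc.mp hm; omega
  rw [χ.toArithmeticFunction_apply hm0, hF]
  congr 1
  push_cast
  refine Finset.sum_congr rfl fun n _ => ?_
  rw [ArithmeticFunction.ppow_apply two_pos, ArithmeticFunction.intCoe_apply]

/-- Convolving with a function supported on 1, 2, 4 multiplies a mean value by the corresponding
Dirichlet polynomial at `s = 1`. -/
theorem tendsto_sum_dyadicFactor_mul_div {f : ArithmeticFunction ℂ} {c : ℂ}
    (hf : Tendsto (fun N : ℕ => (∑ n ∈ Finset.Ioc 0 N, f n) / N) atTop (nhds c)) (u v : ℂ) :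
    Tendsto (fun N : ℕ => (∑ n ∈ Finset.Ioc 0 N, (dyadicFactor u v * f) n) / N) atTop
      (nhds ((1 + u / 2 + v / 4) * c)) := by
  have hk := fun k : ℕ => tendsto_natCast_div_div (F := fun N => ∑ n ∈ Finset.Ioc 0 N, f n) hf k
  have h := ((hk 1).add ((hk 2).const_mul u)).add ((hk 4).const_mul v)
  convert! h.congr' ?_ using 2
  · push_cast
    ring
  filter_upwards [eventually_ge_atTop 4] with N hN
  have hsub : ({1, 2, 4} : Finset ℕ) ⊆ Finset.Ioc 0 N := by
    intro x
    simp only [Finset.mem_insert, Finset.mem_singleton, Finset.mem_Ioc]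
    omega
  rw [ArithmeticFunction.sum_Ioc_mul_eq_sum_sum (dyadicFactor u v) f,
    ← Finset.sum_subset hsub (f := fun n => dyadicFactor u v n * ∑ m ∈ Finset.Ioc 0 (N / n), f m)]
  · rw [Finset.sum_insert (by decide), Finset.sum_insert (by decide), Finset.sum_singleton]
    simp only [dyadicFactor_apply]
    norm_num
    ring
  · intro x _ hx
    simp only [Finset.mem_insert, Finset.mem_singleton, not_or] at hx
    simp [dyadicFactor_apply, hx]

theorem ArithmeticFunction.mul_apply_prime_pow (f g : ArithmeticFunction ℂ) {p : ℕ}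
    (hp : p.Prime) (k : ℕ) :
    (f * g) (p ^ k) = ∑ i ∈ Finset.range (k + 1), f (p ^ i) * g (p ^ (k - i)) := by
  rw [ArithmeticFunction.mul_apply, Nat.sum_divisorsAntidiagonal (fun a b => f a * g b),
    Nat.sum_divisors_prime_pow hp]
  refine Finset.sum_congr rfl fun i hi => ?_
  rw [Nat.pow_div (by simpa [Nat.lt_succ_iff] using hi) hp.pos]

/-- Since `μ²` vanishes at `p ^ j` for `j ≥ 2`, only two terms of the convolution survive. -/
theorem DirichletCharacter.squarefreeMul_prime_pow {M : ℕ} (χ : DirichletCharacter ℂ M) {p : ℕ}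
    (hp : p.Prime) {k : ℕ} (hk : k ≠ 0) :
    χ.squarefreeMul (p ^ k) = χ p ^ k + χ p ^ (k - 1) := by
  obtain ⟨k, rfl⟩ := Nat.exists_eq_succ_of_ne_zero hk
  rw [DirichletCharacter.squarefreeMul, ArithmeticFunction.mul_apply_prime_pow _ _ hp,
    Finset.sum_range_succ, Finset.sum_range_succ, Finset.sum_eq_zero, zero_add]
  · have h1 : k + 1 - k = 1 := by omega
    have h2 : ∀ i, p ^ i ≠ 0 := fun i => pow_ne_zero i hp.ne_zero
    simp only [χ.toArithmeticFunction_apply (h2 _), ArithmeticFunction.ppow_apply two_pos,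
      ArithmeticFunction.intCoe_apply, Nat.succ_eq_add_one, h1, pow_one, Nat.sub_self, pow_zero,
      ArithmeticFunction.moebius_apply_prime hp, ArithmeticFunction.moebius_apply_one]
    push_cast
    simp [add_comm]
  · intro i hi
    rw [Finset.mem_range] at hi
    rw [ArithmeticFunction.ppow_apply two_pos, ArithmeticFunction.intCoe_apply,
      ArithmeticFunction.moebius_apply_prime_pow hp (by omega), if_neg (by omega)]
    simp

theorem dyadicFactor_mul_odd_prime_pow (u v : ℂ) (f : ArithmeticFunction ℂ) {p : ℕ} (hp : p.Prime)
    (hp2 : p ≠ 2) (k : ℕ) : (dyadicFactor u v * f) (p ^ k) = f (p ^ k) := by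
  rw [ArithmeticFunction.mul_apply_prime_pow _ _ hp, Finset.sum_range_succ', Finset.sum_eq_zero]
  · simp [dyadicFactor_apply]
  · intro i _
    have hodd : Odd (p ^ (i + 1)) := (hp.odd_of_ne_two hp2).pow
    have h1 : p ^ (i + 1) ≠ 1 := (Nat.one_lt_pow (Nat.succ_ne_zero i) hp.one_lt).ne'
    have h2 : p ^ (i + 1) ≠ 2 := fun h => by rw [h] at hodd; exact absurd hodd (by decide)
    have h4 : p ^ (i + 1) ≠ 4 := fun h => by rw [h] at hodd; exact absurd hodd (by decide)
    rw [dyadicFactor_apply, if_neg h1, if_neg h2, if_neg h4, zero_mul]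

theorem dyadicFactor_mul_two (u v : ℂ) (f : ArithmeticFunction ℂ) :
    (dyadicFactor u v * f) 2 = f 2 + u * f 1 := by
  have := ArithmeticFunction.mul_apply_prime_pow (dyadicFactor u v) f Nat.prime_two 1
  simpa [Finset.sum_range_succ, dyadicFactor_apply] using this

theorem dyadicFactor_mul_two_pow (u v : ℂ) (f : ArithmeticFunction ℂ) (k : ℕ) :
    (dyadicFactor u v * f) (2 ^ (k + 2)) = f (2 ^ (k + 2)) + u * f (2 ^ (k + 1)) + v * f (2 ^ k) := by
  rw [ArithmeticFunction.mul_apply_prime_pow _ _ Nat.prime_two, Finset.sum_range_succ',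
    Finset.sum_range_succ', Finset.sum_range_succ', Finset.sum_eq_zero]
  · simp only [dyadicFactor_apply]
    norm_num
    ring
  · intro i _
    have h8 : 8 ≤ 2 ^ (i + 1 + 1 + 1) := by
      calc 8 = 2 ^ 3 := by norm_num
        _ ≤ _ := Nat.pow_le_pow_right (by norm_num) (by omega)
    rw [dyadicFactor_apply, if_neg (by omega), if_neg (by omega), if_neg (by omega), zero_mul]

end Convolutions

/-! ### Square roots of `q` modulo prime powers -/

section SquareRoots

/-- The number of square roots of `q` modulo `n`. -/
def sqrtCount (q : ℤ) : ArithmeticFunction ℕ where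
  toFun n := ((Finset.range n).filter fun r : ℕ => (n : ℤ) ∣ (r : ℤ) ^ 2 - q).card
  map_zero' := by simp

theorem sqrtCount_apply (q : ℤ) (n : ℕ) :
    sqrtCount q n = ((Finset.range n).filter fun r : ℕ => (n : ℤ) ∣ (r : ℤ) ^ 2 - q).card := rfl

theorem ZMod.intCast_sq_eq_iff (n : ℕ) (a b : ℤ) :
    (a : ZMod n) ^ 2 = b ↔ (n : ℤ) ∣ a ^ 2 - b := by
  rw [← ZMod.intCast_zmod_eq_zero_iff_dvd, Int.cast_sub, Int.cast_pow, sub_eq_zero]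

theorem sqrtCount_eq_card_filter (q : ℤ) (n : ℕ) [NeZero n] :
    sqrtCount q n = (Finset.univ.filter fun x : ZMod n => x ^ 2 = q).card := by
  rw [sqrtCount_apply]
  refine Finset.card_bij' (fun r _ => (r : ZMod n)) (fun x _ => x.val) ?_ ?_ ?_ ?_
  · intro r hr
    simp only [Finset.mem_filter, Finset.mem_univ, true_and] at hr ⊢
    rw [← ZMod.intCast_sq_eq_iff] at hr
    exact_mod_cast hr.2
  · intro x hx
    simp only [Finset.mem_filter, Finset.mem_univ, true_and, Finset.mem_range] at hx ⊢
    refine ⟨x.val_lt, ?_⟩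
    rw [← ZMod.intCast_sq_eq_iff]
    simpa using hx
  · intro r hr
    exact ZMod.val_cast_of_lt (Finset.mem_range.mp (Finset.mem_filter.mp hr).1)
  · simp

theorem sqrtCount_eq_natCard (q : ℤ) (n : ℕ) [NeZero n] :
    sqrtCount q n = Nat.card {x : ZMod n // x ^ 2 = q} := by
  rw [sqrtCount_eq_card_filter, Nat.card_eq_fintype_card, Fintype.card_subtype]

theorem isMultiplicative_sqrtCount (q : ℤ) : (sqrtCount q).IsMultiplicative := by
  rw [ArithmeticFunction.IsMultiplicative.iff_ne_zero]
  refine ⟨by simp [sqrtCount_apply], fun {m n} hm hn hmn => ?_⟩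
  have := NeZero.mk hm
  have := NeZero.mk hn
  have := NeZero.mk (mul_ne_zero hm hn)
  rw [sqrtCount_eq_natCard, sqrtCount_eq_natCard, sqrtCount_eq_natCard, ← Nat.card_prod]
  refine Nat.card_congr (((ZMod.chineseRemainder hmn).toEquiv.subtypeEquiv (fun x => ?_)).trans
    (Equiv.subtypeProdEquivProd (p := fun x : ZMod m => x ^ 2 = q)
      (q := fun x : ZMod n => x ^ 2 = q)))
  set e := ZMod.chineseRemainder hmn
  have h : x ^ 2 = q ↔ (e x) ^ 2 = (q : ZMod m × ZMod n) := by
    rw [← map_pow, ← map_intCast e, e.injective.eq_iff]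
  rw [h, Prod.ext_iff]
  rfl

theorem sqrtCount_eq_zero {q : ℤ} {n : ℕ} (h : ∀ x : ℤ, ¬ (n : ℤ) ∣ x ^ 2 - q) :
    sqrtCount q n = 0 := by
  rw [sqrtCount_apply, Finset.card_eq_zero, Finset.filter_eq_empty_iff]
  exact fun r _ => h r

/-- Hensel lifting: `p` divides neither 2 nor `q`, so `2 z` is invertible modulo `p` and a Newton
step is available. -/
theorem exists_pow_dvd_sq_sub {p : ℕ} (hp : p.Prime) (hp2 : p ≠ 2) {q : ℤ} (hq : ¬ (p : ℤ) ∣ q)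
    {z₀ : ℤ} (hz₀ : (p : ℤ) ∣ z₀ ^ 2 - q) (k : ℕ) : ∃ z : ℤ, (p : ℤ) ^ (k + 1) ∣ z ^ 2 - q := by
  have hpi : Prime (p : ℤ) := Nat.prime_iff_prime_int.mp hp
  induction k with
  | zero => exact ⟨z₀, by simpa using hz₀⟩
  | succ k ih =>
    obtain ⟨z, t, ht⟩ := ih
    have hz : ¬ (p : ℤ) ∣ z := fun h => hq (by
      have h1 : (p : ℤ) ∣ z ^ 2 - q := (dvd_pow_self _ (Nat.succ_ne_zero k)).trans ⟨t, ht⟩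
      exact (dvd_sub_right (dvd_pow h two_ne_zero)).mp h1)
    have h2 : ¬ (p : ℤ) ∣ 2 := fun h => hp2 ((Nat.prime_dvd_prime_iff_eq hp Nat.prime_two).mp
      (by exact_mod_cast h))
    have hco : IsCoprime (p : ℤ) (2 * z) :=
      hpi.coprime_iff_not_dvd.mpr fun h => (hpi.dvd_or_dvd h).elim h2 hz
    obtain ⟨a, b, hab⟩ := hco
    -- Here `b` inverts `2 z` modulo `p`, so the linear term `t (1 - 2 z b)` equals `t a p` and
    -- supplies the extra factor `p`.
    refine ⟨z + p ^ (k + 1) * (-t * b), t * a + p ^ k * (t * b) ^ 2, ?_⟩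
    have e : (z + p ^ (k + 1) * (-t * b)) ^ 2 - q =
        p ^ (k + 1) * (t * (1 - b * (2 * z))) + p ^ (k + 1) * p ^ (k + 1) * (t * b) ^ 2 := by
      linear_combination ht
    rw [e, show 1 - b * (2 * z) = a * p by linear_combination -hab]
    ring

theorem exists_two_pow_dvd_sq_sub {q : ℤ} (hq : q % 8 = 1) (k : ℕ) :
    ∃ z : ℤ, (2 : ℤ) ^ (k + 3) ∣ z ^ 2 - q := by
  induction k with
  | zero => exact ⟨1, by omega⟩
  | succ k ih =>
    obtain ⟨z, t, ht⟩ := ih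
    have hz : Odd z := by
      by_contra h
      rw [Int.not_odd_iff_even] at h
      obtain ⟨w, rfl⟩ := h
      have : q = 4 * (w * w) - 2 * (2 ^ (k + 2) * t) := by linear_combination -ht
      omega
    obtain ⟨w, rfl⟩ := hz
    -- The correction is by `2 ^ (k + 2)` only, because the derivative `2 z` contributes a factor 2.
    -- The coefficient of `2 ^ (k + 3)` becomes `t (1 + z)`, even as `z` is odd.
    refine ⟨2 * w + 1 + 2 ^ (k + 2) * t, t * (w + 1) + 2 ^ k * t ^ 2, ?_⟩
    linear_combination ht

/-- If `z` is one root, any root `X` has `p ^ (k + 1) ∣ (X - z) (X + z)`. As `p ∤ 2 z`, it divides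
at most one factor, so `X ≡ ± z`, and these two classes differ. -/
theorem sqrtCount_odd_prime_pow {p : ℕ} (hp : p.Prime) (hp2 : p ≠ 2) {q z₀ : ℤ}
    (hq : ¬ (p : ℤ) ∣ q) (hz₀ : (p : ℤ) ∣ z₀ ^ 2 - q) (k : ℕ) :
    sqrtCount q (p ^ (k + 1)) = 2 := by
  have hpi : Prime (p : ℤ) := Nat.prime_iff_prime_int.mp hp
  have := NeZero.mk (pow_ne_zero (k + 1) hp.ne_zero)
  obtain ⟨z, hz⟩ := exists_pow_dvd_sq_sub hp hp2 hq hz₀ k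
  have hpz : ¬ (p : ℤ) ∣ z := fun h => hq
    ((dvd_sub_right (dvd_pow h two_ne_zero)).mp ((dvd_pow_self _ (Nat.succ_ne_zero k)).trans hz))
  have h2 : ¬ (p : ℤ) ∣ 2 := fun h => hp2 ((Nat.prime_dvd_prime_iff_eq hp Nat.prime_two).mp
    (by exact_mod_cast h))
  have h2z : ¬ (p : ℤ) ∣ 2 * z := fun h => (hpi.dvd_or_dvd h).elim h2 hpz
  have hset : (Finset.univ.filter fun x : ZMod (p ^ (k + 1)) => x ^ 2 = q) =
      {(z : ZMod (p ^ (k + 1))), -(z : ZMod (p ^ (k + 1)))} := by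
    ext x
    obtain ⟨X, rfl⟩ := ZMod.intCast_surjective x
    simp only [Finset.mem_filter, Finset.mem_univ, true_and, Finset.mem_insert,
      Finset.mem_singleton]
    rw [ZMod.intCast_sq_eq_iff, eq_neg_iff_add_eq_zero, ← Int.cast_add,
      ← sub_eq_zero (a := (X : ZMod (p ^ (k + 1)))), ← Int.cast_sub,
      ZMod.intCast_zmod_eq_zero_iff_dvd, ZMod.intCast_zmod_eq_zero_iff_dvd, Nat.cast_pow]
    constructor
    · intro h
      have h1 : (p : ℤ) ^ (k + 1) ∣ (X - z) * (X + z) := by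
        have := dvd_sub h hz
        rwa [show X ^ 2 - q - (z ^ 2 - q) = (X - z) * (X + z) by ring] at this
      by_cases h3 : (p : ℤ) ∣ X - z
      · have h4 : ¬ (p : ℤ) ∣ X + z := fun h5 => h2z (by
          have := dvd_sub h5 h3
          rwa [show X + z - (X - z) = 2 * z by ring] at this)
        exact Or.inl ((hpi.coprime_iff_not_dvd.mpr h4).pow_left.dvd_of_dvd_mul_right h1)
      · exact Or.inr ((hpi.coprime_iff_not_dvd.mpr h3).pow_left.dvd_of_dvd_mul_left h1)
    · intro h
      have h1 : (p : ℤ) ^ (k + 1) ∣ (X - z) * (X + z) :=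
        h.elim (fun h => h.mul_right _) fun h => h.mul_left _
      have := dvd_add h1 hz
      rwa [show (X - z) * (X + z) + (z ^ 2 - q) = X ^ 2 - q by ring] at this
  rw [sqrtCount_eq_card_filter, hset, Finset.card_pair]
  intro h
  rw [← sub_eq_zero, sub_neg_eq_add, ← Int.cast_add, ZMod.intCast_zmod_eq_zero_iff_dvd,
    Nat.cast_pow, ← two_mul] at h
  exact h2z ((dvd_pow_self _ (Nat.succ_ne_zero k)).trans h)

/-- For odd roots `X` and `z`, both `X - z` and `X + z` are even but only one is divisible by 4.
Hence `X ≡ ± z` modulo `h = 2 ^ (k + 2)`, and each of these classes splits into two modulo `2 h`. -/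
theorem sqrtCount_two_pow_of_one_mod_eight {q : ℤ} (hq : q % 8 = 1) (k : ℕ) :
    sqrtCount q (2 ^ (k + 3)) = 4 := by
  have := NeZero.mk (pow_ne_zero (k + 3) two_ne_zero (M₀ := ℕ))
  obtain ⟨z, hz⟩ := exists_two_pow_dvd_sq_sub hq k
  have hodd : ∀ X : ℤ, (2 : ℤ) ^ (k + 3) ∣ X ^ 2 - q → X % 2 = 1 := by
    rintro X ⟨t, ht⟩
    by_contra h
    obtain ⟨w, rfl⟩ : ∃ w, X = 2 * w := ⟨X / 2, by omega⟩
    have : q = 4 * (w * w) - 2 * (2 ^ (k + 2) * t) := by linear_combination -ht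
    omega
  have hz1 := hodd z hz
  set n : ℕ := 2 ^ (k + 3) with hn
  have hcast : ∀ a b : ℤ, (a : ZMod n) = b ↔ (2 : ℤ) ^ (k + 3) ∣ a - b := by
    intro a b
    rw [← sub_eq_zero, ← Int.cast_sub, ZMod.intCast_zmod_eq_zero_iff_dvd, hn]
    push_cast
    rfl
  set h : ℤ := 2 ^ (k + 2) with hh
  have hnh : (2 : ℤ) ^ (k + 3) = 2 * h := by rw [hh]; ring
  have hh4 : ∃ j, h = 4 * j := ⟨2 ^ k, by rw [hh]; ring⟩
  have hhpos : 0 < h := by positivity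
  have hset : (Finset.univ.filter fun x : ZMod n => x ^ 2 = q) =
      {((z : ℤ) : ZMod n), ((-z : ℤ) : ZMod n), ((z + h : ℤ) : ZMod n), ((-z + h : ℤ) : ZMod n)} := by
    ext x
    obtain ⟨X, rfl⟩ := ZMod.intCast_surjective x
    simp only [Finset.mem_filter, Finset.mem_univ, true_and, Finset.mem_insert,
      Finset.mem_singleton]
    rw [ZMod.intCast_sq_eq_iff, hcast, hcast, hcast, hcast, hn, Nat.cast_pow, Nat.cast_ofNat, hnh]
    have hfin : ∀ Y w : ℤ, h ∣ Y - w → 2 * h ∣ Y - w ∨ 2 * h ∣ Y - (w + h) := by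
      rintro Y w ⟨s, hs⟩
      rcases Int.even_or_odd' s with ⟨r, rfl | rfl⟩
      · exact Or.inl ⟨r, by linear_combination hs⟩
      · exact Or.inr ⟨r, by linear_combination hs⟩
    constructor
    · intro hX
      have hX1 := hodd X (by rwa [hnh])
      obtain ⟨A, hA⟩ : ∃ A, X - z = 2 * A := ⟨(X - z) / 2, by omega⟩
      obtain ⟨C, hC⟩ : ∃ C, X + z = 2 * C := ⟨(X + z) / 2, by omega⟩
      have h1 : (2 : ℤ) ^ (k + 1) ∣ A * C := by
        obtain ⟨t, ht⟩ := hX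
        obtain ⟨s, hs⟩ := hz
        refine ⟨t - s, ?_⟩
        have : 4 * (A * C) = 4 * (2 ^ (k + 1) * (t - s)) := by
          have e1 : (X - z) * (X + z) = 4 * (A * C) := by rw [hA, hC]; ring
          rw [← e1]
          rw [hnh] at hs
          have e2 : h = 2 * 2 ^ (k + 1) := by rw [hh]; ring
          rw [e2] at ht hs
          linear_combination ht - hs
        linarith
      have h2' : (2 : ℤ) * 2 ^ (k + 1) = h := by rw [hh]; ring
      have hp2 : Prime (2 : ℤ) := Int.prime_two
      have hor : (2 : ℤ) ^ (k + 1) ∣ A ∨ (2 : ℤ) ^ (k + 1) ∣ C := by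
        by_cases hA2 : (2 : ℤ) ∣ A
        · have hC2 : ¬ (2 : ℤ) ∣ C := by omega
          exact Or.inl ((hp2.coprime_iff_not_dvd.mpr hC2).pow_left.dvd_of_dvd_mul_right h1)
        · exact Or.inr ((hp2.coprime_iff_not_dvd.mpr hA2).pow_left.dvd_of_dvd_mul_left h1)
      rcases hor with h3 | h3
      · have := hfin X z (by rw [hA, ← h2']; exact mul_dvd_mul_left 2 h3)
        tauto
      · have := hfin X (-z) (by rw [sub_neg_eq_add, hC, ← h2']; exact mul_dvd_mul_left 2 h3)
        tauto
    · have hz' : 2 * h ∣ z ^ 2 - q := by rwa [hnh] at hz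
      obtain ⟨s, hs⟩ := hz'
      obtain ⟨j, hj⟩ := hh4
      rintro (⟨t, ht⟩ | ⟨t, ht⟩ | ⟨t, ht⟩ | ⟨t, ht⟩)
      · rw [show X = z + 2 * h * t by linarith]
        exact ⟨s + 2 * z * t + 2 * h * t ^ 2, by linear_combination hs⟩
      · rw [show X = -z + 2 * h * t by linarith]
        exact ⟨s - 2 * z * t + 2 * h * t ^ 2, by linear_combination hs⟩
      · rw [show X = z + h * (2 * t + 1) by linarith]
        refine ⟨s + z * (2 * t + 1) + 2 * j * (2 * t + 1) ^ 2, ?_⟩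
        linear_combination hs + h * (2 * t + 1) ^ 2 * hj
      · rw [show X = -z + h * (2 * t + 1) by linarith]
        refine ⟨s - z * (2 * t + 1) + 2 * j * (2 * t + 1) ^ 2, ?_⟩
        linear_combination hs + h * (2 * t + 1) ^ 2 * hj
  have hsmall : ¬ 2 * h ∣ h := fun hd => by have := Int.le_of_dvd hhpos hd; omega
  -- Since `2 z ≡ 2 (mod 4)`, divisibility by 4 separates the classes of `z` and `-z`; the shift by
  -- `h` is seen because `2 h ∤ h`.
  have hfour : ∀ y : ℤ, 2 * h ∣ y → y % 4 = 0 := by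
    rintro y ⟨t, rfl⟩
    obtain ⟨j, hj⟩ := hh4
    rw [hj, show 2 * (4 * j) * t = 4 * (2 * j * t) by ring]
    omega
  obtain ⟨j, hj⟩ := hh4
  rw [sqrtCount_eq_card_filter, hset, Finset.card_insert_of_notMem, Finset.card_insert_of_notMem,
    Finset.card_pair]
  · rw [Ne, hcast, hnh]
    intro hd
    have := hfour _ hd
    omega
  · simp only [Finset.mem_insert, Finset.mem_singleton, hcast, hnh]
    rintro (hd | hd)
    · have := hfour _ hd
      omega
    · rw [show -z - (-z + h) = -h by ring, dvd_neg] at hd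
      exact hsmall hd
  · simp only [Finset.mem_insert, Finset.mem_singleton, hcast, hnh]
    rintro (hd | hd | hd)
    · have := hfour _ hd
      omega
    · rw [show z - (z + h) = -h by ring, dvd_neg] at hd
      exact hsmall hd
    · have := hfour _ hd
      omega

theorem sqrtCount_two {q : ℤ} (hq : q % 2 = 1) : sqrtCount q 2 = 1 := by
  have h : (q : ZMod 2) = 1 := by
    have := (ZMod.intCast_eq_intCast_iff_dvd_sub 1 q 2).mpr (by omega)
    simpa using this.symm
  rw [sqrtCount_eq_card_filter, h]
  decide

theorem sqrtCount_four_of_one_mod_four {q : ℤ} (hq : q % 4 = 1) : sqrtCount q 4 = 2 := by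
  have h : (q : ZMod 4) = 1 := by
    have := (ZMod.intCast_eq_intCast_iff_dvd_sub 1 q 4).mpr (by omega)
    simpa using this.symm
  rw [sqrtCount_eq_card_filter, h]
  decide

theorem not_four_dvd_sq_sub {q : ℤ} (hq : q % 4 = 3) (x : ℤ) : ¬ (4 : ℤ) ∣ x ^ 2 - q := by
  obtain ⟨w, rfl | rfl⟩ := Int.even_or_odd' x
  · rw [show (2 * w) ^ 2 = 4 * (w * w) by ring]; omega
  · rw [show (2 * w + 1) ^ 2 = 4 * (w * w + w) + 1 by ring]; omega

theorem not_eight_dvd_sq_sub {q : ℤ} (hq : q % 8 = 5) (x : ℤ) : ¬ (8 : ℤ) ∣ x ^ 2 - q := by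
  obtain ⟨w, rfl | rfl⟩ := Int.even_or_odd' x
  · rw [show (2 * w) ^ 2 = 4 * (w * w) by ring]; omega
  · obtain ⟨r, hr⟩ := Int.even_mul_succ_self w
    rw [show (2 * w + 1) ^ 2 = 4 * (w * (w + 1)) + 1 by ring]; omega

theorem sqrtCount_natAbs_prime {q : ℤ} (hq : q.natAbs.Prime) : sqrtCount q q.natAbs = 1 := by
  have := Fact.mk hq
  have h : (q : ZMod q.natAbs) = 0 :=
    (ZMod.intCast_zmod_eq_zero_iff_dvd _ _).mpr (Int.natAbs_dvd.mpr dvd_rfl)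
  rw [sqrtCount_eq_card_filter, h, Finset.card_eq_one]
  refine ⟨0, ?_⟩
  ext x
  simp

/-- `q² ∣ x² - q` would force `q ∣ x`, and then `q² ∣ q`. -/
theorem sqrtCount_natAbs_prime_pow {q : ℤ} (hq : q.natAbs.Prime) (k : ℕ) :
    sqrtCount q (q.natAbs ^ (k + 2)) = 0 := by
  refine sqrtCount_eq_zero fun x hx => ?_
  have hp : Prime q := Int.prime_iff_natAbs_prime.mpr hq
  have h1 : q ^ 2 ∣ x ^ 2 - q := by
    refine dvd_trans ?_ hx
    rw [← Int.natAbs_dvd_natAbs, Int.natAbs_pow, Int.natAbs_natCast]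
    exact pow_dvd_pow _ (by omega)
  have h2 : q ∣ x := by
    refine hp.dvd_of_dvd_pow (n := 2) ?_
    have := dvd_add ((dvd_pow_self q two_ne_zero).trans h1) (dvd_refl q)
    rwa [sub_add_cancel] at this
  have h3 : q ^ 2 ∣ q := (dvd_sub_right (pow_dvd_pow_of_dvd h2 2)).mp h1
  have h4 : q * q ∣ q * 1 := by rwa [mul_one, ← sq]
  exact hp.not_isUnit (isUnit_of_dvd_one ((mul_dvd_mul_iff_left hp.ne_zero).mp h4))

/-- Both sides are multiplicative, so prime powers suffice. At odd `p` the values from `p` on are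
`2, 2, …` or `0, 0, …` or `1, 0, 0, …` according as `χ(p)` is 1, -1 or 0. At `1, 2, 4, 8, …` the
root counts are `1, 1, 0, 0, …` for `q ≡ 3 (mod 4)`, `1, 1, 2, 0, …` for `q ≡ 5 (mod 8)` and `1, 1,
2, 4, 4, …` for `q ≡ 1 (mod 8)`; dividing these series by `(1 + x) / (1 - χ(2) x)` yields `u` and
`v`. -/
theorem sqrtCount_eq_dyadicFactor_mul {q : ℤ} (hq : q.natAbs.Prime ∨ q = -1) {M : ℕ}
    {χ : DirichletCharacter ℂ M} {u v : ℂ}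
    (hodd : ∀ p : ℕ, p.Prime → p ≠ 2 → χ p = (jacobiSym q p : ℤ))
    (h2 : (q % 4 = 3 ∧ χ 2 = 0 ∧ u = 0 ∧ v = 0) ∨ (q % 8 = 5 ∧ χ 2 = -1 ∧ u = 1 ∧ v = 2) ∨
      (q % 8 = 1 ∧ χ 2 = 1 ∧ u = -1 ∧ v = 2)) :
    ((sqrtCount q : ArithmeticFunction ℕ) : ArithmeticFunction ℂ) =
      dyadicFactor u v * χ.squarefreeMul := by
  have hmul1 : ((sqrtCount q : ArithmeticFunction ℕ) : ArithmeticFunction ℂ).IsMultiplicative :=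
    (isMultiplicative_sqrtCount q).natCast
  have hmul2 := (isMultiplicative_dyadicFactor u v).mul χ.isMultiplicative_squarefreeMul
  rw [hmul1.eq_iff_eq_on_prime_powers _ _ hmul2]
  intro p i hp
  rcases Nat.eq_zero_or_pos i with rfl | hi
  · rw [pow_zero, hmul1.map_one, hmul2.map_one]
  obtain ⟨k, rfl⟩ : ∃ k, i = k + 1 := ⟨i - 1, by omega⟩
  rw [ArithmeticFunction.natCoe_apply]
  by_cases hp2 : p = 2
  · subst hp2
    have hq2 : q % 2 = 1 := by omega
    have hχ : ∀ j, j ≠ 0 → χ.squarefreeMul (2 ^ j) = χ 2 ^ j + χ 2 ^ (j - 1) := fun j hj => by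
      simpa using χ.squarefreeMul_prime_pow Nat.prime_two hj
    have hχ1 : χ.squarefreeMul 1 = 1 := χ.isMultiplicative_squarefreeMul.map_one
    rcases Nat.eq_zero_or_pos k with rfl | hk
    · have h := hχ 1 one_ne_zero
      rw [pow_one] at h
      rw [zero_add, pow_one, sqrtCount_two hq2, dyadicFactor_mul_two, h, hχ1]
      rcases h2 with ⟨-, h2, rfl, rfl⟩ | ⟨-, h2, rfl, rfl⟩ | ⟨-, h2, rfl, rfl⟩ <;> norm_num [h2]
    obtain ⟨j, rfl⟩ : ∃ j, k = j + 1 := ⟨k - 1, by omega⟩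
    rw [add_assoc, one_add_one_eq_two, dyadicFactor_mul_two_pow, hχ _ (by omega), hχ _ (by omega)]
    rcases h2 with ⟨hq4, h2, rfl, rfl⟩ | ⟨hq8, h2, rfl, rfl⟩ | ⟨hq8, h2, rfl, rfl⟩
    · rw [sqrtCount_eq_zero fun x hx => not_four_dvd_sq_sub hq4 x (dvd_trans ?_ hx)]
      · simp [h2]
      · exact ⟨2 ^ j, by push_cast; ring⟩
    · rcases Nat.eq_zero_or_pos j with rfl | hj
      · norm_num [sqrtCount_four_of_one_mod_four (show q % 4 = 1 by omega), h2, hχ1]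
      obtain ⟨l, rfl⟩ : ∃ l, j = l + 1 := ⟨j - 1, by omega⟩
      rw [sqrtCount_eq_zero fun x hx => not_eight_dvd_sq_sub hq8 x (dvd_trans ?_ hx)]
      · rw [hχ _ (by omega), h2]
        simp only [Nat.cast_zero, Nat.add_sub_cancel, show l + 1 + 2 - 1 = l + 2 by omega]
        ring
      · exact ⟨2 ^ l, by push_cast; ring⟩
    · rcases Nat.eq_zero_or_pos j with rfl | hj
      · norm_num [sqrtCount_four_of_one_mod_four (show q % 4 = 1 by omega), h2, hχ1]
      obtain ⟨l, rfl⟩ : ∃ l, j = l + 1 := ⟨j - 1, by omega⟩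
      rw [show l + 1 + 2 = l + 3 by omega, sqrtCount_two_pow_of_one_mod_eight hq8,
        hχ _ (by omega), h2]
      norm_num
  rw [dyadicFactor_mul_odd_prime_pow _ _ _ hp hp2, χ.squarefreeMul_prime_pow hp (by omega),
    hodd p hp hp2, Nat.add_sub_cancel]
  have := Fact.mk hp
  rw [← jacobiSym.legendreSym.to_jacobiSym]
  by_cases hpq : (p : ℤ) ∣ q
  · have hqp : q.natAbs.Prime := hq.resolve_right fun h => by
      rw [h, Int.dvd_neg] at hpq
      exact hp.one_lt.ne' (Nat.dvd_one.mp (by exact_mod_cast hpq))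
    have hpe : p = q.natAbs := (Nat.prime_dvd_prime_iff_eq hp hqp).mp (Int.natCast_dvd.mp hpq)
    rw [(legendreSym.eq_zero_iff p q).mpr ((ZMod.intCast_zmod_eq_zero_iff_dvd _ _).mpr hpq), hpe]
    rcases Nat.eq_zero_or_pos k with rfl | hk
    · simp [sqrtCount_natAbs_prime hqp]
    · obtain ⟨j, rfl⟩ : ∃ j, k = j + 1 := ⟨k - 1, by omega⟩
      simp [sqrtCount_natAbs_prime_pow hqp, add_assoc]
  · have hq0 : (q : ZMod p) ≠ 0 := fun h => hpq ((ZMod.intCast_zmod_eq_zero_iff_dvd _ _).mp h)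
    rcases legendreSym.eq_one_or_neg_one p hq0 with h | h
    · obtain ⟨y, hy⟩ := (legendreSym.eq_one_iff p hq0).mp h
      obtain ⟨Y, rfl⟩ := ZMod.intCast_surjective y
      rw [sqrtCount_odd_prime_pow hp hp2 hpq (z₀ := Y), h]
      · norm_num
      · rw [← ZMod.intCast_sq_eq_iff, hy, sq]
    · rw [sqrtCount_eq_zero, h]
      · push_cast
        ring
      · intro x hx
        refine (legendreSym.eq_neg_one_iff p).mp h ⟨(x : ZMod p), ?_⟩
        rw [← sq, eq_comm, ZMod.intCast_sq_eq_iff]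
        refine dvd_trans ?_ hx
        rw [Nat.cast_pow]
        exact dvd_pow_self _ (Nat.succ_ne_zero k)

end SquareRoots

/-! ### From pairs to square roots -/

section PairCounting

open Classical in
theorem dCount_two_eq_sum (q : ℤ) (N : ℕ) :
    dCount 2 q N = ∑ b ∈ Finset.Ioc 0 N,
      ((Finset.Ico 1 b).filter fun a : ℕ => IsSquare ((a : ℤ) * b + q)).card := by
  rw [dCount, ← Finset.card_sigma]
  symm
  refine Finset.card_bij (fun x _ => {x.2, x.1}) ?_ ?_ ?_
  · rintro ⟨b, a⟩ h
    simp only [Finset.mem_sigma, Finset.mem_Ioc, Finset.mem_filter, Finset.mem_Ico] at h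
    obtain ⟨⟨hb, hbN⟩, ⟨ha, hab⟩, hsq⟩ := h
    simp only [Finset.mem_filter, Finset.mem_powerset]
    refine ⟨?_, Finset.card_pair hab.ne, ?_, ?_⟩
    · intro x
      simp only [Finset.mem_insert, Finset.mem_singleton, Finset.mem_Icc]
      omega
    · intro x
      simp only [Finset.mem_insert, Finset.mem_singleton]
      omega
    · intro x hx y hy hxy
      simp only [Finset.mem_insert, Finset.mem_singleton] at hx hy
      rcases hx with rfl | rfl <;> rcases hy with rfl | rfl
      · exact absurd rfl hxy
      · exact hsq
      · rwa [mul_comm]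
      · exact absurd rfl hxy
  · rintro ⟨b, a⟩ h ⟨b', a'⟩ h' he
    simp only [Finset.mem_sigma, Finset.mem_Ioc, Finset.mem_filter, Finset.mem_Ico] at h h'
    have h1 : a ∈ ({a', b'} : Finset ℕ) := he ▸ Finset.mem_insert_self a {b}
    have h2 : b ∈ ({a', b'} : Finset ℕ) :=
      he ▸ Finset.mem_insert_of_mem (Finset.mem_singleton_self b)
    simp only [Finset.mem_insert, Finset.mem_singleton] at h1 h2
    obtain ⟨rfl, rfl⟩ : a = a' ∧ b = b' := by omega
    rfl
  · intro S hS
    simp only [Finset.mem_filter, Finset.mem_powerset] at hS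
    obtain ⟨hsub, hcard, hpos, hsq⟩ := hS
    obtain ⟨x, y, hxy, rfl⟩ := Finset.card_eq_two.mp hcard
    have hx : x ∈ ({x, y} : Finset ℕ) := by simp
    have hy : y ∈ ({x, y} : Finset ℕ) := by simp
    have hx1 := Finset.mem_Icc.mp (hsub hx)
    have hy1 := Finset.mem_Icc.mp (hsub hy)
    rcases lt_or_gt_of_ne hxy with h | h
    · refine ⟨⟨y, x⟩, ?_, rfl⟩
      simp only [Finset.mem_sigma, Finset.mem_Ioc, Finset.mem_filter, Finset.mem_Ico]
      exact ⟨by omega, by omega, hsq x hx y hy hxy⟩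
    · refine ⟨⟨x, y⟩, ?_, Finset.pair_comm y x⟩
      simp only [Finset.mem_sigma, Finset.mem_Ioc, Finset.mem_filter, Finset.mem_Ico]
      exact ⟨by omega, by omega, hsq y hy x hx hxy.symm⟩

-- The bijection is `r ↦ (r² - q) / b`. For `0 ≤ r < b` and `|q| < b` the quotient is nonnegative
-- and less than `b`; it is not 0 because `q` is not a square. Conversely `r² = a b + q ≤ b (b - 1)
-- + q < b²` gives `|r| < b`.
open Classical in
theorem card_filter_isSquare_eq_sqrtCount {q : ℤ} (hq : ¬ IsSquare q) {b : ℕ}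
    (hb : q.natAbs < b) :
    ((Finset.Ico 1 b).filter fun a : ℕ => IsSquare ((a : ℤ) * b + q)).card = sqrtCount q b := by
  have hb0 : (0 : ℤ) < b := by omega
  have key : ∀ r : ℕ, r < b → (b : ℤ) ∣ (r : ℤ) ^ 2 - q →
      ∃ a : ℕ, 1 ≤ a ∧ a < b ∧ (r : ℤ) ^ 2 - q = b * a := by
    rintro r hr ⟨c, hc⟩
    have hc0 : c ≠ 0 := by
      rintro rfl
      exact hq ⟨r, by linarith⟩
    have hc1 : 0 < c := by
      by_contra hneg
      have h1 : c ≤ -1 := by omega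
      have h2 : (b : ℤ) * c ≤ b * -1 := mul_le_mul_of_nonneg_left h1 hb0.le
      have h3 : (0 : ℤ) ≤ (r : ℤ) ^ 2 := sq_nonneg _
      omega
    have hcb : c < b := by
      by_contra hge
      have h2 : (b : ℤ) * b ≤ b * c := mul_le_mul_of_nonneg_left (by omega) hb0.le
      have h3 : (r : ℤ) ^ 2 ≤ (b - 1) ^ 2 := by
        have : (r : ℤ) ≤ b - 1 := by omega
        exact pow_le_pow_left₀ (by omega) this 2
      have h4 : ((b : ℤ) - 1) ^ 2 = b * b - 2 * b + 1 := by ring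
      omega
    exact ⟨c.toNat, by omega, by omega, by rw [hc, Int.toNat_of_nonneg hc1.le]⟩
  rw [sqrtCount_apply]
  symm
  refine Finset.card_bij (fun r _ => (((r : ℤ) ^ 2 - q) / b).toNat) ?_ ?_ ?_
  · intro r hr
    rw [Finset.mem_filter, Finset.mem_range] at hr
    obtain ⟨a, ha1, hab, ha⟩ := key r hr.1 hr.2
    rw [Finset.mem_filter, Finset.mem_Ico, ha, Int.mul_ediv_cancel_left _ hb0.ne', Int.toNat_natCast]
    exact ⟨⟨ha1, hab⟩, r, by linear_combination -ha⟩
  · intro r hr s hs h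
    rw [Finset.mem_filter, Finset.mem_range] at hr hs
    obtain ⟨a, ha1, hab, ha⟩ := key r hr.1 hr.2
    obtain ⟨c, hc1, hcb, hc⟩ := key s hs.1 hs.2
    rw [ha, hc, Int.mul_ediv_cancel_left _ hb0.ne', Int.mul_ediv_cancel_left _ hb0.ne',
      Int.toNat_natCast, Int.toNat_natCast] at h
    subst h
    have h1 : r ^ 2 = s ^ 2 := by exact_mod_cast (show (r : ℤ) ^ 2 = (s : ℤ) ^ 2 by linarith)
    exact Nat.pow_left_injective two_ne_zero h1
  · intro a ha
    rw [Finset.mem_filter, Finset.mem_Ico] at ha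
    obtain ⟨⟨ha1, hab⟩, r, hr⟩ := ha
    have hr2 : ((r.natAbs : ℕ) : ℤ) ^ 2 - q = b * a := by
      rw [Int.natCast_natAbs, sq_abs]
      linear_combination -hr
    refine ⟨r.natAbs, ?_, ?_⟩
    · rw [Finset.mem_filter, Finset.mem_range]
      refine ⟨?_, a, hr2⟩
      by_contra hge
      have h1 : (b : ℤ) ^ 2 ≤ ((r.natAbs : ℕ) : ℤ) ^ 2 := pow_le_pow_left₀ hb0.le (by omega) 2
      have h2 : (b : ℤ) * a ≤ b * (b - 1) := mul_le_mul_of_nonneg_left (by omega) hb0.le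
      have h3 : (b : ℤ) * (b - 1) = b ^ 2 - b := by ring
      omega
    · rw [hr2, Int.mul_ediv_cancel_left _ hb0.ne', Int.toNat_natCast]

theorem tendsto_dCount_two_div {q : ℤ} (hq : ¬ IsSquare q) {c : ℂ}
    (h : Tendsto (fun N : ℕ => (∑ n ∈ Finset.Ioc 0 N, (sqrtCount q n : ℂ)) / N) atTop (nhds c)) :
    Tendsto (fun N : ℕ => (dCount 2 q N : ℂ) / N) atTop (nhds c) := by
  classical
  set P : ℕ → ℕ := fun b =>
    ((Finset.Ico 1 b).filter fun a : ℕ => IsSquare ((a : ℤ) * b + q)).card with hP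
  -- Only `b ≤ |q|` can contribute to the discrepancy, so it is a constant for `N ≥ |q|`.
  set E : ℂ := ∑ b ∈ Finset.Ioc 0 q.natAbs, ((P b : ℂ) - sqrtCount q b) with hE
  have h0 : Tendsto (fun N : ℕ => E / N) atTop (nhds 0) := by
    simpa [div_eq_mul_inv] using (tendsto_inv_atTop_nhds_zero_nat (𝕜 := ℂ)).const_mul E
  have h1 := h.add h0
  rw [add_zero] at h1
  refine h1.congr' ?_
  filter_upwards [eventually_ge_atTop q.natAbs] with N hN
  rw [← add_div, dCount_two_eq_sum]
  congr 1
  have h2 : E = ∑ b ∈ Finset.Ioc 0 N, ((P b : ℂ) - sqrtCount q b) := by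
    refine Finset.sum_subset (Finset.Ioc_subset_Ioc_right hN) fun b hb hb' => ?_
    simp only [Finset.mem_Ioc] at hb hb'
    rw [hP]
    simp only
    rw [card_filter_isSquare_eq_sqrtCount hq (by omega), sub_self]
  rw [h2, Finset.sum_sub_distrib, Nat.cast_sum]
  ring

end PairCounting

/-! ### Nontriviality of the Kronecker character and the asymptotics -/

section KroneckerCharacter

theorem not_isSquare_of_natAbs_prime {q : ℤ} (hq : q.natAbs.Prime ∨ q = -1) : ¬ IsSquare q := by
  rcases hq with hq | rfl
  · exact (Int.prime_iff_natAbs_prime.mpr hq).irreducible.not_isSquare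
  · rintro ⟨r, hr⟩
    nlinarith [mul_self_nonneg r]

theorem kroneckerChar_ne_one_of_kroneckerSym_eq_neg_one {D : ℤ} [NeZero D]
    (hD : D % 4 = 0 ∨ D % 4 = 1) {n : ℕ} (hn : kroneckerSym D n = -1) : kroneckerChar D hD ≠ 1 := by
  intro h
  have h1 := kroneckerChar_natCast D hD n
  rw [h, hn] at h1
  by_cases hu : IsUnit (n : ZMod D.natAbs)
  · rw [MulChar.one_apply hu] at h1
    norm_num at h1
  · rw [MulChar.map_nonunit _ hu] at h1
    norm_num at h1

/-- The number `m = 2|q| + 1` is 1 modulo `|q|` and 3 modulo 4, so reciprocity evaluates the symbol.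
The sign comes from reciprocity itself if `q > 0`, and from `(-1 / m)` if `q < 0`. -/
theorem jacobiSym_two_mul_natAbs_add_one {q : ℤ} (hq : q % 4 = 3) :
    jacobiSym q (2 * q.natAbs + 1 : ℕ) = -1 := by
  set n := q.natAbs with hn
  have hodd : Odd n := Nat.odd_iff.mpr (by omega)
  have hm : Odd (2 * n + 1) := ⟨n, rfl⟩
  have hm4 : (2 * n + 1) % 4 = 3 := by omega
  have h1 : jacobiSym ((2 * n + 1 : ℕ) : ℤ) n = 1 := by
    rw [jacobiSym.mod_left, show (((2 * n + 1 : ℕ) : ℤ) % n) = 1 % n by push_cast; simp,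
      ← jacobiSym.mod_left, jacobiSym.one_left]
  rcases le_total 0 q with h0 | h0
  · have hqn : q = (n : ℤ) := by omega
    rw [hqn, jacobiSym.quadratic_reciprocity_three_mod_four (by omega) hm4, h1]
  · have hqn : q = -1 * (n : ℤ) := by omega
    rw [hqn, jacobiSym.mul_left, jacobiSym.at_neg_one hm, ZMod.χ₄_nat_three_mod_four hm4,
      jacobiSym.quadratic_reciprocity_one_mod_four (by omega) hm, h1]
    norm_num

/-- The symbol is the Legendre symbol modulo the odd prime `|q|`, so any nonresidue will do. -/
theorem exists_kroneckerSym_eq_neg_one {q : ℤ} (hq : q.natAbs.Prime) (hq4 : q % 4 = 1) :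
    ∃ n : ℕ, kroneckerSym q n = -1 := by
  have := Fact.mk hq
  obtain ⟨a, ha⟩ := FiniteField.exists_nonsquare (F := ZMod q.natAbs) (by
    rw [ZMod.ringChar_zmod_n]
    omega)
  refine ⟨a.val, ?_⟩
  rw [kroneckerSym_of_one_mod_four hq4, ← jacobiSym.legendreSym.to_jacobiSym,
    legendreSym.eq_neg_one_iff]
  simpa using ha

theorem kroneckerSym_two (q : ℤ) : kroneckerSym q (2 : ℕ) = ZMod.χ₈ (q : ZMod 8) := by
  rw [kroneckerSym_natCast _ two_ne_zero, Nat.prime_two.factorization_self]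
  simp

theorem isEquivalent_dCount_two {q D : ℤ} [NeZero D] (hq : q.natAbs.Prime ∨ q = -1)
    (hD : D % 4 = 0 ∨ D % 4 = 1) (hχ : kroneckerChar D hD ≠ 1) {u v w : ℂ}
    (hodd : ∀ p : ℕ, p.Prime → p ≠ 2 → jacobiSym D p = jacobiSym q p)
    (h2 : (q % 4 = 3 ∧ kroneckerSym D (2 : ℕ) = 0 ∧ u = 0 ∧ v = 0) ∨
      (q % 8 = 5 ∧ kroneckerSym D (2 : ℕ) = -1 ∧ u = 1 ∧ v = 2) ∨
      (q % 8 = 1 ∧ kroneckerSym D (2 : ℕ) = 1 ∧ u = -1 ∧ v = 2))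
    (hw : w = 1 + u / 2 + v / 4) (hw0 : w ≠ 0) :
    (fun N : ℕ => (dCount 2 q N : ℂ)) ~[atTop]
      fun N : ℕ => w * (kroneckerChar D hD).LFunction 1 / riemannZeta 2 * (N : ℂ) := by
  set χ := kroneckerChar D hD with hχdef
  have hχ2 : χ 2 = (kroneckerSym D (2 : ℕ) : ℤ) := by
    rw [← kroneckerChar_natCast D hD 2, Nat.cast_ofNat]
  have hconv := sqrtCount_eq_dyadicFactor_mul (χ := χ) (u := u) (v := v) hq
    (fun p hp hp2 => by
      rw [← hodd p hp hp2, hχdef, kroneckerChar_natCast,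
        kroneckerSym_of_odd _ (hp.eq_two_or_odd.resolve_left hp2)])
    (by
      rcases h2 with ⟨h, h2, hu, hv⟩ | ⟨h, h2, hu, hv⟩ | ⟨h, h2, hu, hv⟩
      · exact Or.inl ⟨h, by rw [hχ2, h2]; simp, hu, hv⟩
      · exact Or.inr (Or.inl ⟨h, by rw [hχ2, h2]; simp, hu, hv⟩)
      · exact Or.inr (Or.inr ⟨h, by rw [hχ2, h2]; simp, hu, hv⟩))
  have hlim := tendsto_sum_dyadicFactor_mul_div (χ.tendsto_sum_squarefreeMul_div hχ) u v
  rw [← hconv, ← hw, ← mul_div_assoc] at hlim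
  have hd := tendsto_dCount_two_div (not_isSquare_of_natAbs_prime hq) hlim
  set C := w * χ.LFunction 1 / riemannZeta 2 with hC
  -- The nonvanishing of `L(1, χ)` is what allows division by the limit.
  have hC0 : C ≠ 0 := div_ne_zero (mul_ne_zero hw0 (χ.LFunction_apply_one_ne_zero hχ))
    (riemannZeta_ne_zero_of_one_lt_re (by norm_num))
  refine isEquivalent_of_tendsto_one ?_
  have := hd.div_const C
  rw [div_self hC0] at this
  refine this.congr fun N => ?_
  rw [Pi.div_apply, div_div, mul_comm C]

end KroneckerCharacter

theorem theorem2 (q : ℤ) [NeZero q] (hq : q.natAbs.Prime ∨ q = -1) :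
    (q ≡ 3 [ZMOD 4] →
      (fun N : ℕ => (dCount 2 q N : ℂ)) ~[atTop]
        fun N : ℕ => (kroneckerChar (4 * q) (four_mul_disc q)).LFunction 1 /
          riemannZeta 2 * (N : ℂ)) ∧
    (∀ h : q ≡ 5 [ZMOD 8],
      (fun N : ℕ => (dCount 2 q N : ℂ)) ~[atTop]
        fun N : ℕ => 2 * (kroneckerChar q (disc_of_five_mod_eight h)).LFunction 1 /
          riemannZeta 2 * (N : ℂ)) ∧
    (∀ h : q ≡ 1 [ZMOD 8],
      (fun N : ℕ => (dCount 2 q N : ℂ)) ~[atTop]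
        fun N : ℕ => (kroneckerChar q (disc_of_one_mod_eight h)).LFunction 1 /
          riemannZeta 2 * (N : ℂ)) := by
  -- The value `q = -1` is 3 modulo 4, so it occurs only in the first case.
  have hprime : q % 4 = 1 → q.natAbs.Prime := fun h => hq.resolve_right (by omega)
  refine ⟨fun h => ?_, fun h => ?_, fun h => ?_⟩
  · have h4 : q % 4 = 3 := h
    have hodd : ∀ n : ℕ, n % 2 = 1 → jacobiSym (4 * q) n = jacobiSym q n := fun n hn => by
      rw [← jacobiSym.div_four_left (by omega) hn, Int.mul_ediv_cancel_left q (by norm_num)]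
    have hχ : kroneckerChar (4 * q) (four_mul_disc q) ≠ 1 :=
      kroneckerChar_ne_one_of_kroneckerSym_eq_neg_one (four_mul_disc q)
        (n := 2 * q.natAbs + 1) (by
          rw [kroneckerSym_of_odd _ (by omega), hodd _ (by omega)]
          exact jacobiSym_two_mul_natAbs_add_one h4)
    have := isEquivalent_dCount_two hq (four_mul_disc q) hχ (u := 0) (v := 0) (w := 1)
      (fun p hp hp2 => hodd p (hp.eq_two_or_odd.resolve_left hp2))
      (Or.inl ⟨h4, kroneckerSym_of_even (by omega) rfl, rfl, rfl⟩) (by norm_num) one_ne_zero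
    simpa only [one_mul] using this
  · have h8 : q % 8 = 5 := h
    obtain ⟨n, hn⟩ := exists_kroneckerSym_eq_neg_one (hprime (by omega)) (by omega)
    refine isEquivalent_dCount_two hq (disc_of_five_mod_eight h)
      (kroneckerChar_ne_one_of_kroneckerSym_eq_neg_one _ hn) (u := 1) (v := 2)
      (fun _ _ _ => rfl) (Or.inr (Or.inl ⟨h8, ?_, rfl, rfl⟩)) (by norm_num) two_ne_zero
    rw [kroneckerSym_two, ZMod.χ₈_int_eq_if_mod_eight, if_neg (by omega), if_neg (by omega)]
  · have h8 : q % 8 = 1 := h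
    obtain ⟨n, hn⟩ := exists_kroneckerSym_eq_neg_one (hprime (by omega)) (by omega)
    have := isEquivalent_dCount_two hq (disc_of_one_mod_eight h)
      (kroneckerChar_ne_one_of_kroneckerSym_eq_neg_one _ hn) (u := -1) (v := 2) (w := 1)
      (fun _ _ _ => rfl) (Or.inr (Or.inr ⟨h8, by
        rw [kroneckerSym_two, ZMod.χ₈_int_eq_if_mod_eight, if_neg (by omega),
          if_pos (Or.inl h8)], rfl, rfl⟩)) (by norm_num) one_ne_zero
    simpa only [one_mul] using this
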